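/- For $n \ge 2$ let $L_n$ be the triplet group, i.e. the Coxeter group with generators $y_1,\dots,y_{n-1}$ and relations $y_j^2=1$ $(1\le j\le n-1)$ and $y_iy_{i+1}y_i=y_{i+1}y_iy_{i+1}$ $(1\le i\le n-2)$. Let $\pi\colon L_n\to S_n$ be the homomorphism with $\pi(y_i)=(i\ \,i+1)$, let $PL_n=\ker\pi$, and let $PL_n'$ be the commutator subgroup of $PL_n$. A group is called crystallographic of dimension $d$ if it is isomorphic to a discrete subgroup $\Gamma$ of $\mathbb{R}^d\rtimes \mathrm{O}(d,\mathbb{R})$ that is uniform (closed, with compact quotient $(\mathbb{R}^d\rtimes \mathrm{O}(d,\mathbb{R}))/\Gamma$), and Bieberbach of dimension $d$ if in addition it is torsion-free. Theorem. Let $n\ge 4$. The inclusion $PL_n\subseteq L_n$ and the map $\pi$ induce a short exact sequence $$1\longrightarrow PL_n/PL_n'\longrightarrow L_n/PL_n'\stackrel{\pi}{\longrightarrow} S_n\longrightarrow 1 .$$ The group $L_n/PL_n'$ is crystallographic of dimension $d=1+n!\left(\frac{2n-7}{6}\right)$, and it is so through this extension: there is an isomorphism from $L_n/PL_n'$ onto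 a discrete uniform subgroup of $\mathbb{R}^d\rtimes \mathrm{O}(d,\mathbb{R})$ under which the elements of $PL_n/PL_n'$ are exactly those that are sent to translations. Furthermore, $L_n/PL_n'$ has elements of order $2$ and elements of order $3$, and it is not a Bieberbach group (of any dimension). -/

import Mathlib

/-! ### The Euclidean group `ℝᵈ ⋊ O(d, ℝ)` and crystallographic groups -/

/-- The action of `O(d, ℝ)` on the (multiplicatively written) additive group `ℝᵈ` by
matrix-vector multiplication. -/
def orthogonalAction (d : ℕ) :
    Matrix.orthogonalGroup (Fin d) ℝ →* MulAut (Multiplicative (Fin d → ℝ)) where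
  toFun A := AddEquiv.toMultiplicative
    { toFun := fun v => Matrix.mulVec (A : Matrix (Fin d) (Fin d) ℝ) v
      invFun := fun v => Matrix.mulVec ((A⁻¹ : Matrix.orthogonalGroup (Fin d) ℝ) :
        Matrix (Fin d) (Fin d) ℝ) v
      left_inv := fun v => by
        dsimp only
        rw [Matrix.mulVec_mulVec, ← Submonoid.coe_mul, inv_mul_cancel, Submonoid.coe_one,
          Matrix.one_mulVec]
      right_inv := fun v => by
        dsimp only
        rw [Matrix.mulVec_mulVec, ← Submonoid.coe_mul, mul_inv_cancel, Submonoid.coe_one,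
          Matrix.one_mulVec]
      map_add' := fun v w => Matrix.mulVec_add _ v w }
  map_one' := by
    ext v : 1
    exact congrArg Multiplicative.ofAdd (Matrix.one_mulVec (Multiplicative.toAdd v))
  map_mul' A B := by
    ext v : 1
    exact congrArg Multiplicative.ofAdd
      (Matrix.mulVec_mulVec (Multiplicative.toAdd v) (A : Matrix (Fin d) (Fin d) ℝ)
        (B : Matrix (Fin d) (Fin d) ℝ)).symm

/-- The Euclidean group `ℝᵈ ⋊ O(d, ℝ)`; `g.left` is the translation part and `g.right` is the
linear part of `g`. -/
abbrev EuclideanGroup (d : ℕ) : Type :=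
  Multiplicative (Fin d → ℝ) ⋊[orthogonalAction d] Matrix.orthogonalGroup (Fin d) ℝ

/-- The topology of `ℝᵈ ⋊ O(d, ℝ)` is the product topology of `ℝᵈ × O(d, ℝ)`. -/
instance EuclideanGroup.instTopologicalSpace (d : ℕ) : TopologicalSpace (EuclideanGroup d) :=
  TopologicalSpace.induced (fun g => (g.left, g.right)) inferInstance

theorem EuclideanGroup.isInducing (d : ℕ) :
    Topology.IsInducing (fun g : EuclideanGroup d => (g.left, g.right)) := ⟨rfl⟩

instance EuclideanGroup.instT2Space (d : ℕ) : T2Space (EuclideanGroup d) := by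
  refine T2Space.of_injective_continuous
    (f := fun g : EuclideanGroup d => (g.left, g.right)) ?_ (EuclideanGroup.isInducing d).continuous
  intro a b h
  exact SemidirectProduct.ext (congrArg Prod.fst h) (congrArg Prod.snd h)

theorem continuous_orthogonalAction (d : ℕ) :
    Continuous (fun p : Matrix.orthogonalGroup (Fin d) ℝ × Multiplicative (Fin d → ℝ) =>
      orthogonalAction d p.1 p.2) := by
  have h : Continuous (fun p : Matrix.orthogonalGroup (Fin d) ℝ × Multiplicative (Fin d → ℝ) =>
      Matrix.mulVec (p.1 : Matrix (Fin d) (Fin d) ℝ) (Multiplicative.toAdd p.2)) :=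
    Continuous.matrix_mulVec (continuous_subtype_val.comp continuous_fst)
      (continuous_toAdd.comp continuous_snd)
  exact continuous_ofAdd.comp h

instance EuclideanGroup.instIsTopologicalGroup (d : ℕ) :
    IsTopologicalGroup (EuclideanGroup d) := by
  have hl : Continuous (fun g : EuclideanGroup d => g.left) :=
    continuous_fst.comp (EuclideanGroup.isInducing d).continuous
  have hr : Continuous (fun g : EuclideanGroup d => g.right) :=
    continuous_snd.comp (EuclideanGroup.isInducing d).continuous
  have hinv : Continuous (fun A : Matrix.orthogonalGroup (Fin d) ℝ => A⁻¹) :=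
    Continuous.subtype_mk (Continuous.star continuous_subtype_val) _
  have hmul : Continuous (fun p : EuclideanGroup d × EuclideanGroup d => p.1 * p.2) := by
    refine (EuclideanGroup.isInducing d).continuous_iff.2 ?_
    have h1 : Continuous (fun p : EuclideanGroup d × EuclideanGroup d =>
        p.1.left * orthogonalAction d p.1.right p.2.left) := by
      have h2 : Continuous (fun p : EuclideanGroup d × EuclideanGroup d =>
          orthogonalAction d p.1.right p.2.left) :=
        (continuous_orthogonalAction d).comp
          (f := fun p : EuclideanGroup d × EuclideanGroup d => (p.1.right, p.2.left))
          ((hr.comp continuous_fst).prodMk (hl.comp continuous_snd))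
      exact Continuous.mul (hl.comp continuous_fst) h2
    have h3 : Continuous (fun p : EuclideanGroup d × EuclideanGroup d =>
        p.1.right * p.2.right) :=
      Continuous.mul (hr.comp continuous_fst) (hr.comp continuous_snd)
    exact h1.prodMk h3
  have hi : Continuous (fun g : EuclideanGroup d => g⁻¹) := by
    refine (EuclideanGroup.isInducing d).continuous_iff.2 ?_
    have h1 : Continuous (fun g : EuclideanGroup d =>
        orthogonalAction d g.right⁻¹ g.left⁻¹) :=
      (continuous_orthogonalAction d).comp
        (f := fun g : EuclideanGroup d => (g.right⁻¹, g.left⁻¹))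
        ((hinv.comp hr).prodMk hl.inv)
    exact h1.prodMk (hinv.comp hr)
  exact { continuous_mul := hmul, continuous_inv := hi }

/-- A subgroup `H` of a Hausdorff topological group `G` is uniform if it is closed and `G / H` is
compact. -/
def IsUniformSubgroup {G : Type*} [Group G] [TopologicalSpace G] [IsTopologicalGroup G]
    [T2Space G] (H : Subgroup G) : Prop :=
  IsClosed (H : Set G) ∧ CompactSpace (G ⧸ H)

/-- Discrete and uniform subgroups of `ℝᵈ ⋊ O(d, ℝ)`. -/
def IsCrystallographicSubgroup {d : ℕ} (Γ : Subgroup (EuclideanGroup d)) : Prop :=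
  DiscreteTopology Γ ∧ IsUniformSubgroup Γ

/-- An abstract group is crystallographic of dimension `d` if it is isomorphic to a discrete and
uniform subgroup of `ℝᵈ ⋊ O(d, ℝ)`. -/
def IsCrystallographicGroup (d : ℕ) (G : Type*) [Group G] : Prop :=
  ∃ Γ : Subgroup (EuclideanGroup d), IsCrystallographicSubgroup Γ ∧ Nonempty (G ≃* Γ)

/-- A Bieberbach group of dimension `d` is a torsion-free crystallographic group of dimension `d`.
(Torsion-free: no element except `1` has finite order.) -/
def IsBieberbachGroup (d : ℕ) (G : Type*) [Group G] : Prop :=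
  IsCrystallographicGroup d G ∧ ∀ g : G, IsOfFinOrder g → g = 1

/-! ### Triplet groups -/

/-- The Coxeter matrix of the triplet group `L_n`: the generators `y_i`, `y_j` satisfy the braid
relation `(y_i y_j)³ = 1` when `|i - j| = 1`, and no relation when `|i - j| ≥ 2` (the entry `0`
stands for `∞`). -/
def tripletMatrix (n : ℕ) : CoxeterMatrix (Fin (n - 1)) where
  M := Matrix.of fun i j =>
    if i = j then 1 else if (i : ℕ) + 1 = j ∨ (j : ℕ) + 1 = i then 3 else 0
  isSymm := by
    ext i j
    simp only [Matrix.transpose_apply, Matrix.of_apply, eq_comm (a := i) (b := j),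
      or_comm (a := (i : ℕ) + 1 = j)]
  diagonal := by simp
  off_diagonal i j h := by
    simp only [Matrix.of_apply, if_neg h]
    split_ifs <;> simp

/-- The triplet group `L_n`. -/
abbrev TripletGroup (n : ℕ) : Type := (tripletMatrix n).Group

/-- The adjacent transposition `τ_i = (i, i+1)` of `S_n`, with indices starting at `0`. -/
def adjacentSwap (n : ℕ) (i : Fin (n - 1)) : Equiv.Perm (Fin n) :=
  Equiv.swap ⟨i, by omega⟩ ⟨i + 1, by omega⟩

theorem adjacentSwap_mul_pow_three (n : ℕ) (i j : Fin (n - 1)) (h : (i : ℕ) + 1 = j) :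
    (adjacentSwap n i * adjacentSwap n j) ^ 3 = 1 ∧
      (adjacentSwap n j * adjacentSwap n i) ^ 3 = 1 := by
  have h3 : (adjacentSwap n i * adjacentSwap n j).IsThreeCycle := by
    have hj : (⟨(j : ℕ), by omega⟩ : Fin n) = ⟨i + 1, by omega⟩ := by
      ext; simp [h]
    unfold adjacentSwap
    rw [hj, Equiv.swap_comm (⟨(i : ℕ), by omega⟩ : Fin n) ⟨i + 1, by omega⟩]
    apply Equiv.Perm.isThreeCycle_swap_mul_swap_same <;> simp [Fin.ext_iff] <;> omega
  refine ⟨by rw [← h3.orderOf]; exact pow_orderOf_eq_one _, ?_⟩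
  have h3' : (adjacentSwap n j * adjacentSwap n i) = (adjacentSwap n i * adjacentSwap n j)⁻¹ := by
    simp [adjacentSwap, mul_inv_rev]
  rw [h3', inv_pow, ← h3.orderOf, pow_orderOf_eq_one, inv_one]

theorem tripletMatrix_isLiftable (n : ℕ) : (tripletMatrix n).IsLiftable (adjacentSwap n) := by
  intro i j
  simp only [tripletMatrix, Matrix.of_apply]
  split_ifs with h1 h2
  · subst h1; simp [adjacentSwap]
  · rcases h2 with h2 | h2
    · exact (adjacentSwap_mul_pow_three n i j h2).1
    · exact (adjacentSwap_mul_pow_three n j i h2).2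
  · simp

/-- The natural map `π : L_n → S_n`, which sends `y_i` to `τ_i`. -/
noncomputable def tripletToPerm (n : ℕ) : TripletGroup n →* Equiv.Perm (Fin n) :=
  (tripletMatrix n).toCoxeterSystem.lift ⟨adjacentSwap n, tripletMatrix_isLiftable n⟩

theorem tripletToPerm_simple (n : ℕ) (i : Fin (n - 1)) :
    tripletToPerm n ((tripletMatrix n).simple i) = adjacentSwap n i := by
  rw [← CoxeterMatrix.toCoxeterSystem_simple]
  exact CoxeterSystem.lift_apply_simple _ (tripletMatrix_isLiftable n) i

/-- The pure triplet group `PL_n`, the kernel of `π : L_n → S_n`. -/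
noncomputable abbrev PureTripletGroup (n : ℕ) : Subgroup (TripletGroup n) :=
  (tripletToPerm n).ker

/-- The quotient `L_n / PL_n'`, where `PL_n' = [PL_n, PL_n]`. -/
abbrev TripletQuotient (n : ℕ) : Type :=
  TripletGroup n ⧸ ⁅PureTripletGroup n, PureTripletGroup n⁆

/-! Conceptually, `L_n` is a chain of amalgams: copies `⟨y_i, y_{i+1}⟩` of `S_3` glued along the
`⟨y_{i+1}⟩`. As `π` is injective on each copy, `PL_n` acts freely on the Bass–Serre tree, so
`PL_n/PL_n'` is `H_1` of the quotient graph. Its vertices and edges are cosets in `S_n` of `n-2`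
copies of `S_3` and `n-3` subgroups of order 2, whence the rank `1 + (n-3) n!/2 - (n-2) n!/6 = d`.

The proof replaces the tree by algebra. `pathChain` is a crossed homomorphism from `L_n` to the
1-chains of the graph. On `PL_n` it is a homomorphism whose kernel is exactly `PL_n'`:
`chainClass_pathChain` recovers, from the integral chain of a pure element, the class of a conjugate
in the abelianization. The real span of its values on `PL_n` is the cycle space (`span_pathChain`),
whose dimension comes from the Euler characteristic (`finrank_cycles`).

`S_n` permutes the edges, so it acts orthogonally on the cycle space, and faithfully by
`eq_one_of_permLinear_cycles`. Together with the path chain this yields a map to the Euclidean group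
(`exists_crystallographic_hom`): its kernel is `PL_n'`, its linear part is trivial exactly on
`PL_n`, integrality of chains makes the image discrete and the spanning property makes it cocompact.
Torsion survives in the quotient because `y_1` and `y_1 y_2` have the same order in `L_n` and in
`S_n`. -/

/-! ### Generalities: permutation modules, pairs of braided involutions, equivariant sections -/

section PermutationModules

variable {Q X : Type*} [Group Q] [MulAction Q X]

/-- The action of a group on the functions on a set it acts on, by `(w f) x = f (w⁻¹ x)`. -/
def permLinear (R : Type*) [CommRing R] (w : Q) : (X → R) ≃ₗ[R] (X → R) :=
  LinearEquiv.funCongrLeft R R (MulAction.toPerm w⁻¹)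

variable {R : Type*} [CommRing R]

theorem permLinear_apply (w : Q) (f : X → R) (x : X) : permLinear R w f x = f (w⁻¹ • x) := rfl

theorem permLinear_one (f : X → R) : permLinear R (1 : Q) f = f := by
  ext x; simp [permLinear_apply]

theorem permLinear_mul (w w' : Q) (f : X → R) :
    permLinear R (w * w') f = permLinear R w (permLinear R w' f) := by
  ext x; simp [permLinear_apply, mul_smul]

theorem permLinear_single [DecidableEq X] (w : Q) (x : X) (r : R) :
    permLinear R w (Pi.single x r) = Pi.single (w • x) r := by
  ext y
  simp only [permLinear_apply, Pi.single_apply, inv_smul_eq_iff]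

/-- The permutations of the underlying set given by `permLinear`. -/
def permHom (Q X R : Type*) [Group Q] [MulAction Q X] [CommRing R] :
    Q →* Equiv.Perm (X → R) where
  toFun w := (permLinear R w).toEquiv
  map_one' := Equiv.ext fun f => permLinear_one f
  map_mul' w w' := Equiv.ext fun f => permLinear_mul w w' f

/-- The affine map with linear part `permLinear R w` that fixes `P`. -/
def permAffine (P : X → R) (w : Q) : Equiv.Perm (X → R) :=
  Equiv.addLeft P * permHom Q X R w * (Equiv.addLeft P)⁻¹

theorem permAffine_apply (P : X → R) (w : Q) (f : X → R) :
    permAffine P w f = P - permLinear R w P + permLinear R w f := by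
  have : permAffine P w f = P + permLinear R w (-P + f) := rfl
  rw [this, map_add, map_neg]
  abel

theorem permAffine_one (P : X → R) : permAffine P (1 : Q) = 1 := by
  rw [permAffine, map_one, mul_one, mul_inv_cancel]

theorem permAffine_mul (P : X → R) (w w' : Q) :
    permAffine P (w * w') = permAffine P w * permAffine P w' := by
  rw [permAffine, permAffine, permAffine, map_mul]
  group

/-- The map depends on the fixed point only modulo vectors fixed by `w`. This lets a generator be
computed from either of two adjacent base vertices. -/
theorem permAffine_congr {P P' : X → R} {w : Q}
    (h : permLinear R w (P - P') = P - P') : permAffine P w = permAffine P' w := by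
  ext1 f
  rw [permAffine_apply, permAffine_apply]
  rw [map_sub] at h
  have : P - permLinear R w P = P' - permLinear R w P' := by
    rw [sub_eq_sub_iff_sub_eq_sub, h]
  rw [this]

end PermutationModules

/-! ### Subgroups generated by two braided involutions have the size of `S_3`. -/

section BraidedInvolutions

variable {G : Type*} [Group G] {a b : G}

/-- The list of six words is stable under left multiplication by `a` and by `b`. -/
theorem mem_of_mem_closure_braided (ha : a * a = 1) (hb : b * b = 1)
    (h : a * b * a = b * a * b) {x : G} (hx : x ∈ Subgroup.closure {a, b}) :
    x = 1 ∨ x = a ∨ x = b ∨ x = a * b ∨ x = b * a ∨ x = a * b * a := by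
  have ha' : a⁻¹ = a := inv_eq_of_mul_eq_one_left ha
  have hb' : b⁻¹ = b := inv_eq_of_mul_eq_one_left hb
  have ha2 : ∀ y, a * (a * y) = y := fun y => by rw [← mul_assoc, ha, one_mul]
  have hb2 : ∀ y, b * (b * y) = y := fun y => by rw [← mul_assoc, hb, one_mul]
  have key : ∀ x, (x = 1 ∨ x = a ∨ x = b ∨ x = a * b ∨ x = b * a ∨ x = a * b * a) →
      ∀ y, (y = a ∨ y = b) →
      (y * x = 1 ∨ y * x = a ∨ y * x = b ∨ y * x = a * b ∨ y * x = b * a ∨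
        y * x = a * b * a) := by
    rintro x hx y (rfl | rfl)
    · rcases hx with rfl | rfl | rfl | rfl | rfl | rfl <;> simp [mul_assoc, ha, ha2]
    · rcases hx with rfl | rfl | rfl | rfl | rfl | rfl
      · simp
      · simp
      · simp [hb]
      · rw [← mul_assoc, ← h]; simp
      · simp [hb2]
      · rw [h, mul_assoc y, hb2]; simp
  induction hx using Subgroup.closure_induction_left with
  | one => simp
  | mul_left y hy x _ ih => exact key x ih y (by simpa using hy)
  | inv_mul_cancel y hy x _ ih =>
    refine key x ih _ ?_
    rcases hy with rfl | rfl
    · exact Or.inl ha'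
    · exact Or.inr hb'

theorem finite_closure_braided (ha : a * a = 1) (hb : b * b = 1)
    (h : a * b * a = b * a * b) :
    Finite (Subgroup.closure {a, b}) ∧ Nat.card (Subgroup.closure {a, b}) ≤ 6 := by
  classical
  have hsub : ((Subgroup.closure {a, b} : Subgroup G) : Set G) ⊆
      (({1, a, b, a * b, b * a, a * b * a} : Finset G) : Set G) := by
    intro x hx
    have := mem_of_mem_closure_braided ha hb h hx
    simpa using this
  have hfin := (Finset.finite_toSet _).subset hsub
  refine ⟨hfin, ?_⟩
  have h1 := Set.ncard_le_ncard hsub (Finset.finite_toSet _)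
  rw [Set.ncard_coe_finset] at h1
  exact h1.trans Finset.card_le_six

theorem card_closure_braided (ha : orderOf a = 2) (hb : b * b = 1) (hab : orderOf (a * b) = 3)
    (h : a * b * a = b * a * b) : Nat.card (Subgroup.closure {a, b}) = 6 := by
  have ha2 : a * a = 1 := by rw [← pow_two, ← ha, pow_orderOf_eq_one]
  obtain ⟨hfin, hle⟩ := finite_closure_braided ha2 hb h
  have hma : a ∈ Subgroup.closure {a, b} := Subgroup.subset_closure (by simp)
  have hmb : b ∈ Subgroup.closure {a, b} := Subgroup.subset_closure (by simp)
  have h2 := Subgroup.orderOf_dvd_natCard _ hma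
  have h3 := Subgroup.orderOf_dvd_natCard _ (Subgroup.mul_mem _ hma hmb)
  have hpos : 0 < Nat.card (Subgroup.closure {a, b}) := Nat.card_pos
  rw [ha] at h2
  rw [hab] at h3
  omega

end BraidedInvolutions

section Cosets

variable {G Q A : Type*} [Group G] [Group Q]

/-- Choose one representative in each coset of `p(H)`, lift it arbitrarily, and extend over the
coset by `H`; injectivity on `H` makes the extension unambiguous. -/
theorem exists_equivariant_section (p : G →* Q) (hp : Function.Surjective p) (H : Subgroup G)
    (hH : Set.InjOn p H) :
    ∃ s : Q → G, (∀ w, p (s w) = w) ∧ ∀ w, ∀ h ∈ H, s (w * p h) = s w * h := by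
  have hex : ∀ w : Q, ∃ h ∈ H, p h = (Quotient.out (w : Q ⧸ H.map p))⁻¹ * w := fun w => by
    have : (Quotient.out (w : Q ⧸ H.map p))⁻¹ * w ∈ H.map p :=
      QuotientGroup.eq.1 (QuotientGroup.out_eq' (w : Q ⧸ H.map p))
    simpa using this
  choose k hkH hk using hex
  refine ⟨fun w => Function.surjInv hp (Quotient.out (w : Q ⧸ H.map p)) * k w, ?_, ?_⟩
  · intro w
    rw [map_mul, Function.surjInv_eq hp, hk, mul_inv_cancel_left]
  · intro w h hh
    have hq : ((w * p h : Q) : Q ⧸ H.map p) = (w : Q ⧸ H.map p) := by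
      rw [eq_comm, QuotientGroup.eq]
      exact ⟨h, hh, by group⟩
    have hkk : k (w * p h) = k w * h := by
      refine hH (hkH _) (H.mul_mem (hkH _) hh) ?_
      rw [map_mul, hk, hk, hq, mul_assoc]
    simp only [hq, hkk, mul_assoc]

/-- The map on `Q ⧸ ⟨S⟩` induced by a function invariant under right multiplication by `S`. -/
def cosetLift {S : Set Q} (F : Q → A) (hF : ∀ s ∈ S, ∀ w, F (w * s) = F w) :
    Q ⧸ Subgroup.closure S → A :=
  Quotient.lift F fun w w' h => by
    have h1 : w⁻¹ * w' ∈ Subgroup.closure S := QuotientGroup.leftRel_apply.1 h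
    have h2 : ∀ x ∈ Subgroup.closure S, ∀ w, F (w * x) = F w := by
      intro x hx
      induction hx using Subgroup.closure_induction with
      | mem x hx => exact hF x hx
      | one => simp
      | mul x y _ _ hx hy => intro w; rw [← mul_assoc, hy, hx]
      | inv x _ hx => intro w; rw [← hx (w * x⁻¹), inv_mul_cancel_right]
    rw [← h2 _ h1 w, mul_inv_cancel_left]

end Cosets

/-! ### The graph of groups of a triplet group -/

namespace Triplet

variable {m : ℕ}

/-- The generators of the triplet group `L_{m+4}`. -/
def gen (i : Fin (m + 3)) : TripletGroup (m + 4) := (tripletMatrix (m + 4)).simple i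

/-- The adjacent transpositions of `S_{m+4}`. -/
def adj (i : Fin (m + 3)) : Equiv.Perm (Fin (m + 4)) := Equiv.swap i.castSucc i.succ

theorem tripletToPerm_gen (i : Fin (m + 3)) : tripletToPerm (m + 4) (gen i) = adj i :=
  tripletToPerm_simple (m + 4) i

theorem adj_mul_self (i : Fin (m + 3)) : adj i * adj i = 1 := Equiv.swap_mul_self _ _

theorem orderOf_adj (i : Fin (m + 3)) : orderOf (adj i) = 2 :=
  orderOf_eq_prime (by rw [pow_two, adj_mul_self]) (by
    intro h
    have := congrArg (fun f : Equiv.Perm (Fin (m + 4)) => f i.castSucc) h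
    simp [adj, Fin.ext_iff] at this)

theorem orderOf_adj_mul_adj (i : Fin (m + 2)) : orderOf (adj i.castSucc * adj i.succ) = 3 := by
  refine Equiv.Perm.IsThreeCycle.orderOf ?_
  unfold adj
  rw [Equiv.swap_comm, ← Fin.succ_castSucc]
  apply Equiv.Perm.isThreeCycle_swap_mul_swap_same <;> grind

theorem gen_mul_self (i : Fin (m + 3)) : gen i * gen i = 1 := by
  have := (tripletMatrix (m + 4)).toCoxeterSystem.simple_mul_simple_self i
  rwa [CoxeterMatrix.toCoxeterSystem_simple] at this

theorem gen_mul_gen_pow_three (i : Fin (m + 2)) :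
    (gen i.castSucc * gen i.succ) ^ 3 = 1 := by
  have := (tripletMatrix (m + 4)).toCoxeterSystem.simple_mul_simple_pow i.castSucc i.succ
  rw [CoxeterMatrix.toCoxeterSystem_simple] at this
  have h : (tripletMatrix (m + 4)).M i.castSucc i.succ = 3 := by
    simp only [tripletMatrix, Matrix.of_apply]
    rw [if_neg (by simp [Fin.ext_iff]), if_pos (by simp)]
  rwa [h] at this

theorem gen_braid (i : Fin (m + 2)) :
    gen i.castSucc * gen i.succ * gen i.castSucc = gen i.succ * gen i.castSucc * gen i.succ := by
  have h := gen_mul_gen_pow_three i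
  have h1 : (gen i.castSucc * gen i.succ * gen i.castSucc) *
      (gen i.succ * gen i.castSucc * gen i.succ) = 1 := by
    rw [← h]; simp only [pow_succ, pow_zero, one_mul, mul_assoc]
  rw [eq_inv_of_mul_eq_one_left h1]
  have hi : ∀ j : Fin (m + 3), (gen j)⁻¹ = gen j := fun j =>
    inv_eq_of_mul_eq_one_left (gen_mul_self j)
  simp only [mul_inv_rev, hi, mul_assoc]

theorem adj_braid (i : Fin (m + 2)) :
    adj i.castSucc * adj i.succ * adj i.castSucc = adj i.succ * adj i.castSucc * adj i.succ := by
  have := congrArg (tripletToPerm (m + 4)) (gen_braid i)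
  simpa only [map_mul, tripletToPerm_gen] using this

theorem gen_induction {p : TripletGroup (m + 4) → Prop} (g : TripletGroup (m + 4)) (one : p 1)
    (mul : ∀ g (i : Fin (m + 3)), p g → p (gen i * g)) : p g := by
  refine (tripletMatrix (m + 4)).toCoxeterSystem.simple_induction_left g one ?_
  rw [CoxeterMatrix.toCoxeterSystem_simple]
  exact mul

theorem exists_hom {H : Type*} [Group H] (f : Fin (m + 3) → H) (h1 : ∀ i, f i * f i = 1)
    (h3 : ∀ i : Fin (m + 2), (f i.castSucc * f i.succ) ^ 3 = 1) :
    ∃ φ : TripletGroup (m + 4) →* H, ∀ i, φ (gen i) = f i := by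
  have h3' : ∀ i : Fin (m + 2), (f i.succ * f i.castSucc) ^ 3 = 1 := fun i => by
    have hi : f i.succ * f i.castSucc = (f i.castSucc * f i.succ)⁻¹ := by
      rw [mul_inv_rev, inv_eq_of_mul_eq_one_left (h1 _), inv_eq_of_mul_eq_one_left (h1 _)]
    rw [hi, inv_pow, h3, inv_one]
  have hf : (tripletMatrix (m + 4)).IsLiftable f := by
    intro i j
    simp only [tripletMatrix, Matrix.of_apply]
    split_ifs with h h'
    · subst h; rw [pow_one, h1]
    · rcases h' with h' | h'
      · have hj := j.2
        have := h3 ⟨i, by omega⟩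
        rwa [show Fin.succ (⟨i, by omega⟩ : Fin (m + 2)) = j from Fin.ext h'] at this
      · have hi := i.2
        have := h3' ⟨j, by omega⟩
        rwa [show Fin.succ (⟨j, by omega⟩ : Fin (m + 2)) = i from Fin.ext h'] at this
    · rw [pow_zero]
  refine ⟨(tripletMatrix (m + 4)).toCoxeterSystem.lift ⟨f, hf⟩, fun i => ?_⟩
  have := (tripletMatrix (m + 4)).toCoxeterSystem.lift_apply_simple hf i
  rwa [CoxeterMatrix.toCoxeterSystem_simple] at this

theorem tripletToPerm_surjective : Function.Surjective (tripletToPerm (m + 4)) := by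
  rw [← MonoidHom.mrange_eq_top, eq_top_iff, ← Equiv.Perm.mclosure_swap_castSucc_succ,
    Submonoid.closure_le]
  rintro _ ⟨i, rfl⟩
  exact ⟨gen i, tripletToPerm_gen i⟩

/-- The edges of the quotient graph: the cosets of the subgroups generated by one of the
transpositions `adj 1`, ..., `adj (m + 1)`. -/
def Edge (m : ℕ) : Type :=
  Σ j : Fin (m + 1), Equiv.Perm (Fin (m + 4)) ⧸ Subgroup.closure {(adj j.succ.castSucc)}

/-- The vertices of the quotient graph: the cosets of the subgroups generated by two successive
adjacent transpositions. -/
def Vertex (m : ℕ) : Type :=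
  Σ i : Fin (m + 2), Equiv.Perm (Fin (m + 4)) ⧸ Subgroup.closure {adj i.castSucc, adj i.succ}

noncomputable instance : Fintype (Edge m) :=
  @Fintype.ofFinite _ (inferInstanceAs (Finite (Σ _ : Fin (m + 1), _ ⧸ _)))
noncomputable instance : Fintype (Vertex m) :=
  @Fintype.ofFinite _ (inferInstanceAs (Finite (Σ _ : Fin (m + 2), _ ⧸ _)))
noncomputable instance : DecidableEq (Edge m) := Classical.decEq _
noncomputable instance : DecidableEq (Vertex m) := Classical.decEq _
instance : MulAction (Equiv.Perm (Fin (m + 4))) (Edge m) :=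
  inferInstanceAs (MulAction _ (Σ _ : Fin (m + 1), _ ⧸ _))

/-- The edge given by the coset of `w`. -/
def edge (j : Fin (m + 1)) (w : Equiv.Perm (Fin (m + 4))) : Edge m := ⟨j, (w : _ ⧸ _)⟩

/-- The vertex given by the coset of `w`. -/
def vertex (i : Fin (m + 2)) (w : Equiv.Perm (Fin (m + 4))) : Vertex m := ⟨i, (w : _ ⧸ _)⟩

theorem exists_edge_eq (e : Edge m) : ∃ j w, edge j w = e := by
  obtain ⟨j, w⟩ := e
  obtain ⟨w, rfl⟩ := QuotientGroup.mk_surjective w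
  exact ⟨j, w, rfl⟩

theorem exists_vertex_eq (v : Vertex m) : ∃ i w, vertex i w = v := by
  obtain ⟨j, w⟩ := v
  obtain ⟨w, rfl⟩ := QuotientGroup.mk_surjective w
  exact ⟨j, w, rfl⟩

theorem smul_edge (u : Equiv.Perm (Fin (m + 4))) (j : Fin (m + 1))
    (w : Equiv.Perm (Fin (m + 4))) : u • edge j w = edge j (u * w) := rfl

theorem edge_mul_adj (j : Fin (m + 1)) (w : Equiv.Perm (Fin (m + 4))) :
    edge j (w * adj j.succ.castSucc) = edge j w := by
  refine congrArg (Sigma.mk j) ?_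
  rw [eq_comm, QuotientGroup.eq, inv_mul_cancel_left]
  exact Subgroup.subset_closure rfl

theorem vertex_mul {i : Fin (m + 2)} {s : Equiv.Perm (Fin (m + 4))}
    (hs : s = adj i.castSucc ∨ s = adj i.succ) (w : Equiv.Perm (Fin (m + 4))) :
    vertex i (w * s) = vertex i w := by
  refine congrArg (Sigma.mk i) ?_
  rw [eq_comm, QuotientGroup.eq, inv_mul_cancel_left]
  exact Subgroup.subset_closure hs

section Lift

variable {A : Type*}

/-- A function on edges, given on representatives. -/
def edgeLift (F : Fin (m + 1) → Equiv.Perm (Fin (m + 4)) → A)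
    (hF : ∀ j w, F j (w * adj j.succ.castSucc) = F j w) (e : Edge m) : A :=
  cosetLift (F e.1) (by rintro _ rfl; exact hF e.1) e.2

theorem edgeLift_edge (F : Fin (m + 1) → Equiv.Perm (Fin (m + 4)) → A)
    (hF : ∀ j w, F j (w * adj j.succ.castSucc) = F j w) (j w) :
    edgeLift F hF (edge j w) = F j w := rfl

/-- A function on vertices, given on representatives. -/
def vertexLift (F : Fin (m + 2) → Equiv.Perm (Fin (m + 4)) → A)
    (hF : ∀ i s, (s = adj i.castSucc ∨ s = adj i.succ) → ∀ w, F i (w * s) = F i w)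
    (v : Vertex m) : A :=
  cosetLift (F v.1) (fun s hs => hF v.1 s hs) v.2

theorem vertexLift_vertex (F : Fin (m + 2) → Equiv.Perm (Fin (m + 4)) → A)
    (hF : ∀ i s, (s = adj i.castSucc ∨ s = adj i.succ) → ∀ w, F i (w * s) = F i w) (i w) :
    vertexLift F hF (vertex i w) = F i w := rfl

end Lift

/-! ### Counting edges and vertices. -/

theorem two_mul_card_edge :
    2 * Fintype.card (Edge m) = (m + 1) * Nat.factorial (m + 4) := by
  have h : ∀ j : Fin (m + 1), 2 * Nat.card (Equiv.Perm (Fin (m + 4)) ⧸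
      Subgroup.closure {(adj j.succ.castSucc)}) = Nat.factorial (m + 4) := fun j => by
    have h1 := Subgroup.card_eq_card_quotient_mul_card_subgroup
      (Subgroup.closure {(adj j.succ.castSucc)})
    rw [← Subgroup.zpowers_eq_closure, Nat.card_zpowers, orderOf_adj, Nat.card_perm,
      Nat.card_eq_fintype_card, Fintype.card_fin] at h1
    rw [← Subgroup.zpowers_eq_closure, h1, mul_comm]
  rw [← Nat.card_eq_fintype_card]
  change 2 * Nat.card (Σ j : Fin (m + 1), _ ⧸ _) = _
  rw [Nat.card_sigma, Finset.mul_sum, Finset.sum_congr rfl fun j _ => h j]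
  simp

theorem six_mul_card_vertex :
    6 * Fintype.card (Vertex m) = (m + 2) * Nat.factorial (m + 4) := by
  have h : ∀ i : Fin (m + 2), 6 * Nat.card (Equiv.Perm (Fin (m + 4)) ⧸
      Subgroup.closure {adj i.castSucc, adj i.succ}) = Nat.factorial (m + 4) := fun i => by
    have h1 := Subgroup.card_eq_card_quotient_mul_card_subgroup
      (Subgroup.closure {adj i.castSucc, adj i.succ})
    rw [card_closure_braided (orderOf_adj _) (adj_mul_self _) (orderOf_adj_mul_adj i)
      (adj_braid i), Nat.card_perm, Nat.card_eq_fintype_card, Fintype.card_fin] at h1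
    rw [h1, mul_comm]
  rw [← Nat.card_eq_fintype_card]
  change 6 * Nat.card (Σ i : Fin (m + 2), _ ⧸ _) = _
  rw [Nat.card_sigma, Finset.mul_sum, Finset.sum_congr rfl fun i _ => h i]
  simp

/-! ### The crossed homomorphism given by paths in the graph -/

section Chains

variable (R : Type*) [CommRing R]

/-- The chain of an edge. -/
noncomputable def edgeChain (j : Fin (m + 1)) (w : Equiv.Perm (Fin (m + 4))) : Edge m → R :=
  Pi.single (edge j w) 1

theorem permLinear_edgeChain (u : Equiv.Perm (Fin (m + 4))) (j : Fin (m + 1))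
    (w : Equiv.Perm (Fin (m + 4))) :
    permLinear R u (edgeChain R j w) = edgeChain R j (u * w) := by
  rw [edgeChain, permLinear_single, smul_edge, edgeChain]

/-- The chain of the path from the vertex `(0, 1)` to the vertex `(k, 1)`. -/
noncomputable def basePath (k : ℕ) : Edge m → R :=
  ∑ j : Fin (m + 1), if (j : ℕ) < k then edgeChain R j 1 else 0

theorem basePath_zero : basePath R 0 = (0 : Edge m → R) := by simp [basePath]

theorem basePath_succ (j : Fin (m + 1)) :
    basePath R (j + 1) = basePath R j + edgeChain R j 1 := by
  have : edgeChain R j 1 = ∑ i : Fin (m + 1), if i = j then edgeChain R i 1 else 0 := by simp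
  rw [this, basePath, basePath, ← Finset.sum_add_distrib]
  refine Finset.sum_congr rfl fun i _ => ?_
  rcases lt_trichotomy i j with h | rfl | h
  · have h' : (i : ℕ) < j := h
    rw [if_pos (by omega), if_pos h', if_neg h.ne, add_zero]
  · simp
  · have h' : (j : ℕ) < i := h
    rw [if_neg (by omega), if_neg (by omega), if_neg h.ne', add_zero]

theorem basePath_last : (basePath R (m + 2) : Edge m → R) = basePath R (m + 1) := by
  refine Finset.sum_congr rfl fun i _ => ?_
  rw [if_pos (by omega), if_pos (by omega)]

/-- Generator `i + 1` stabilizes both base vertices `i` and `i + 1`. The paths to them differ by one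
edge, which `adj i.succ` fixes, so both fixed points define the same affine map. -/
theorem permAffine_succ (i : Fin (m + 2)) :
    permAffine (basePath R (i + 1) : Edge m → R) (adj i.succ) =
      permAffine (basePath R i) (adj i.succ) := by
  refine permAffine_congr ?_
  cases i using Fin.lastCases with
  | last =>
    -- There is no base vertex `m + 2`: the path stops at `m + 1` and nothing changes.
    rw [Fin.val_last, basePath_last, sub_self, map_zero]
  | cast j =>
    rw [Fin.val_castSucc, basePath_succ, add_sub_cancel_left, permLinear_edgeChain, mul_one]
    have := edge_mul_adj j 1
    rw [one_mul] at this
    rw [edgeChain, Fin.succ_castSucc, this, edgeChain]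

theorem exists_affineAction : ∃ φ : TripletGroup (m + 4) →* Equiv.Perm (Edge m → R),
    ∀ i : Fin (m + 3), φ (gen i) = permAffine (basePath R i) (adj i) := by
  refine exists_hom _ (fun i => ?_) fun i => ?_
  · rw [← permAffine_mul, adj_mul_self, permAffine_one]
  · have h : (adj i.castSucc * adj i.succ) ^ 3 = 1 := by
      rw [← orderOf_adj_mul_adj i, pow_orderOf_eq_one]
    -- Moved to the common base vertex `i`, both generators act through the homomorphism `permAffine
    -- (basePath R i)`, so the braid relation is inherited from `S_n`.
    rw [Fin.val_succ, permAffine_succ, Fin.val_castSucc, ← permAffine_mul, pow_succ, pow_two,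
      ← permAffine_mul, ← permAffine_mul, ← pow_two, ← pow_succ, h, permAffine_one]

/-- The action of the triplet group on chains by affine maps, where the stabilizer of the `k`-th
base vertex fixes the chain of the path to this vertex. -/
noncomputable def affineAction : TripletGroup (m + 4) →* Equiv.Perm (Edge m → R) :=
  (exists_affineAction R).choose

theorem affineAction_gen (i : Fin (m + 3)) :
    affineAction R (gen i) = permAffine (basePath R i) (adj i) :=
  (exists_affineAction R).choose_spec i

/-- The chain of a path from the base vertex to its image under `g`. -/
noncomputable def pathChain (g : TripletGroup (m + 4)) : Edge m → R := affineAction R g 0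

theorem affineAction_apply (g : TripletGroup (m + 4)) (x : Edge m → R) :
    affineAction R g x = pathChain R g + permLinear R (tripletToPerm (m + 4) g) x := by
  induction g using gen_induction generalizing x with
  | one =>
    rw [pathChain, map_one, map_one, permLinear_one]
    simp
  | mul g i ih =>
    rw [pathChain, map_mul, Equiv.Perm.mul_apply, Equiv.Perm.mul_apply, ih, ih 0, map_zero,
      add_zero, affineAction_gen, permAffine_apply, permAffine_apply, map_mul, permLinear_mul,
      map_add, tripletToPerm_gen, add_assoc]

theorem pathChain_one : pathChain R (1 : TripletGroup (m + 4)) = 0 := by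
  rw [pathChain, map_one]; rfl

theorem pathChain_mul (g h : TripletGroup (m + 4)) :
    pathChain R (g * h) =
      pathChain R g + permLinear R (tripletToPerm (m + 4) g) (pathChain R h) := by
  rw [← affineAction_apply, pathChain, pathChain, map_mul, Equiv.Perm.mul_apply]

theorem pathChain_gen (i : Fin (m + 3)) :
    pathChain R (gen i) = basePath R i - permLinear R (adj i) (basePath R i) := by
  rw [pathChain, affineAction_gen, permAffine_apply, map_zero, add_zero]

theorem pathChain_gen_of_incident {i : Fin (m + 3)} {k : Fin (m + 2)}
    (h : i = k.castSucc ∨ i = k.succ) :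
    pathChain R (gen i) = basePath R k - permLinear R (adj i) (basePath R k) := by
  rcases h with rfl | rfl
  · exact pathChain_gen R _
  · rw [pathChain, affineAction_gen, Fin.val_succ, permAffine_succ, permAffine_apply, map_zero,
      add_zero]

theorem exists_incident (i : Fin (m + 3)) : ∃ k : Fin (m + 2), i = k.castSucc ∨ i = k.succ := by
  cases i using Fin.lastCases with
  | last => exact ⟨Fin.last _, Or.inr rfl⟩
  | cast k => exact ⟨k, Or.inl rfl⟩

/-- Integrality serves twice: it gives discreteness of the translation lattice, and it turns
vanishing of a real chain into vanishing of the integral one. -/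
theorem pathChain_intCast (g : TripletGroup (m + 4)) (e : Edge m) :
    pathChain R g e = (pathChain ℤ g e : R) := by
  have hb : ∀ (k : ℕ) (e : Edge m), basePath R k e = (basePath ℤ k e : R) := by
    intro k e
    simp only [basePath, Finset.sum_apply, Int.cast_sum]
    refine Finset.sum_congr rfl fun j _ => ?_
    split_ifs <;> simp [edgeChain, Pi.single_apply]
  induction g using gen_induction generalizing e with
  | one => simp [pathChain_one]
  | mul g i ih =>
    simp only [pathChain_mul, pathChain_gen, Pi.add_apply, Pi.sub_apply, permLinear_apply, ih, hb,
      Int.cast_add, Int.cast_sub]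

end Chains

end Triplet

namespace Triplet

variable {m : ℕ}

/-! ### The path chain detects the commutator subgroup of the pure triplet group -/

/-- The subgroup has at most six elements and its image has exactly six. This is the algebraic form
of the freeness of the action of `PL_n` on the tree. -/
theorem injOn_closure_gen (i : Fin (m + 2)) :
    Set.InjOn (tripletToPerm (m + 4))
      (Subgroup.closure {gen i.castSucc, gen i.succ} : Subgroup (TripletGroup (m + 4))) := by
  set H : Subgroup (TripletGroup (m + 4)) := Subgroup.closure {gen i.castSucc, gen i.succ} with hH
  obtain ⟨hfin, hle⟩ := finite_closure_braided (gen_mul_self i.castSucc) (gen_mul_self i.succ)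
    (gen_braid i)
  have hmap : H.map (tripletToPerm (m + 4)) = Subgroup.closure {adj i.castSucc, adj i.succ} := by
    rw [hH, MonoidHom.map_closure, Set.image_pair, tripletToPerm_gen, tripletToPerm_gen]
  have hcard : Nat.card (H.map (tripletToPerm (m + 4))) = 6 := by
    rw [hmap]
    exact card_closure_braided (orderOf_adj _) (adj_mul_self _) (orderOf_adj_mul_adj i)
      (adj_braid i)
  have hsurj := (tripletToPerm (m + 4)).subgroupMap_surjective H
  have hbij := hsurj.bijective_of_nat_card_le (by rw [hcard]; exact hle)
  intro x hx y hy hxy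
  exact congrArg Subtype.val (hbij.1 (a₁ := ⟨x, hx⟩) (a₂ := ⟨y, hy⟩) (Subtype.ext hxy))

theorem exists_lift (i : Fin (m + 2)) : ∃ s : Equiv.Perm (Fin (m + 4)) → TripletGroup (m + 4),
    (∀ w, tripletToPerm (m + 4) (s w) = w) ∧
      ∀ w, ∀ k : Fin (m + 3), (k = i.castSucc ∨ k = i.succ) → s (w * adj k) = s w * gen k := by
  obtain ⟨s, h1, h2⟩ := exists_equivariant_section _ tripletToPerm_surjective _
    (injOn_closure_gen i)
  refine ⟨s, h1, fun w k hk => ?_⟩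
  rw [← tripletToPerm_gen, h2]
  refine Subgroup.subset_closure ?_
  rcases hk with rfl | rfl <;> simp

/-- A section of the map to the symmetric group that is equivariant under the stabilizer of the
`i`-th base vertex. -/
noncomputable def lift (i : Fin (m + 2)) (w : Equiv.Perm (Fin (m + 4))) : TripletGroup (m + 4) :=
  (exists_lift i).choose w

theorem tripletToPerm_lift (i : Fin (m + 2)) (w : Equiv.Perm (Fin (m + 4))) :
    tripletToPerm (m + 4) (lift i w) = w := (exists_lift i).choose_spec.1 w

theorem lift_mul_adj {i : Fin (m + 2)} {k : Fin (m + 3)} (hk : k = i.castSucc ∨ k = i.succ)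
    (w : Equiv.Perm (Fin (m + 4))) : lift i (w * adj k) = lift i w * gen k :=
  (exists_lift i).choose_spec.2 w k hk

open Classical in
/-- The class of a pure element in the abelianization of the pure triplet group. -/
noncomputable def abClass (g : TripletGroup (m + 4)) :
    Additive (Abelianization (PureTripletGroup (m + 4))) :=
  if h : g ∈ PureTripletGroup (m + 4) then Additive.ofMul (Abelianization.of ⟨g, h⟩) else 0

theorem abClass_mul {g h : TripletGroup (m + 4)} (hg : tripletToPerm (m + 4) g = 1)
    (hh : tripletToPerm (m + 4) h = 1) : abClass (g * h) = abClass g + abClass h := by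
  have hg' : g ∈ PureTripletGroup (m + 4) := hg
  have hh' : h ∈ PureTripletGroup (m + 4) := hh
  rw [abClass, abClass, abClass, dif_pos hg', dif_pos hh', dif_pos (Subgroup.mul_mem _ hg' hh'),
    ← ofMul_mul, ← map_mul]
  rfl

theorem abClass_one : abClass (1 : TripletGroup (m + 4)) = 0 := by
  have := abClass_mul (m := m) (map_one _) (map_one _)
  rwa [mul_one, left_eq_add] at this

/-- The class of `a b⁻¹`. -/
noncomputable def divClass (a b : TripletGroup (m + 4)) :
    Additive (Abelianization (PureTripletGroup (m + 4))) := abClass (a * b⁻¹)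

theorem divClass_add {a b c : TripletGroup (m + 4)}
    (hab : tripletToPerm (m + 4) a = tripletToPerm (m + 4) b)
    (hbc : tripletToPerm (m + 4) b = tripletToPerm (m + 4) c) :
    divClass a b + divClass b c = divClass a c := by
  rw [divClass, divClass, ← abClass_mul]
  · rw [divClass]; congr 1; group
  · rw [map_mul, map_inv, hab, mul_inv_cancel]
  · rw [map_mul, map_inv, hbc, mul_inv_cancel]

theorem divClass_self (a : TripletGroup (m + 4)) : divClass a a = 0 := by
  rw [divClass, mul_inv_cancel, abClass_one]

theorem divClass_mul_right (a b c : TripletGroup (m + 4)) :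
    divClass (a * c) (b * c) = divClass a b := by
  rw [divClass, divClass]; congr 1; group

/-- The homomorphism on integral chains that recovers the class of a pure element from its path
chain. -/
noncomputable def chainClass :
    (Edge m → ℤ) →ₗ[ℤ] Additive (Abelianization (PureTripletGroup (m + 4))) :=
  Fintype.linearCombination ℤ (edgeLift (fun j w => divClass (lift j.castSucc w) (lift j.succ w))
    fun j w => by
      rw [lift_mul_adj (Or.inl rfl), lift_mul_adj (Or.inr (Fin.succ_castSucc j).symm),
        divClass_mul_right])

theorem chainClass_edgeChain (j : Fin (m + 1)) (w : Equiv.Perm (Fin (m + 4))) :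
    chainClass (edgeChain ℤ j w) = divClass (lift j.castSucc w) (lift j.succ w) := by
  rw [chainClass, edgeChain, Fintype.linearCombination_apply_single, one_smul, edgeLift_edge]

/-- The classes of consecutive edges telescope along the path. -/
theorem chainClass_basePath (w : Equiv.Perm (Fin (m + 4))) (k : Fin (m + 2)) :
    chainClass (permLinear ℤ w (basePath ℤ k)) = divClass (lift 0 w) (lift k w) := by
  induction k using Fin.induction with
  | zero => rw [Fin.val_zero, basePath_zero, map_zero, map_zero, divClass_self]
  | succ j ih =>
    rw [Fin.val_castSucc] at ih
    rw [Fin.val_succ, basePath_succ, map_add, map_add, ih, permLinear_edgeChain, mul_one,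
      chainClass_edgeChain, divClass_add] <;> simp only [tripletToPerm_lift]

/-- Quotients of lifts telescope along a word for `g`; at each letter, equivariance of `lift k`
under the stabilizer of an incident vertex `k` cancels the detour to that vertex and back. -/
theorem chainClass_pathChain (g : TripletGroup (m + 4)) (w : Equiv.Perm (Fin (m + 4))) :
    chainClass (permLinear ℤ w (pathChain ℤ g)) =
      divClass (lift 0 w * g) (lift 0 (w * tripletToPerm (m + 4) g)) := by
  induction g using gen_induction generalizing w with
  | one => rw [pathChain_one, map_zero, map_zero, map_one, mul_one, mul_one, divClass_self]
  | mul g i ih =>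
    obtain ⟨k, hk⟩ := exists_incident i
    have h1 : divClass (lift 0 w) (lift k w) - divClass (lift 0 (w * adj i)) (lift k (w * adj i)) =
        divClass (lift 0 w * gen i) (lift 0 (w * adj i)) := by
      rw [sub_eq_iff_eq_add, divClass_add, lift_mul_adj hk, divClass_mul_right] <;>
        simp only [map_mul, tripletToPerm_lift, tripletToPerm_gen]
    rw [pathChain_mul, map_add, map_add, pathChain_gen_of_incident ℤ hk, map_sub, map_sub,
      ← permLinear_mul, ← permLinear_mul, tripletToPerm_gen, chainClass_basePath,
      chainClass_basePath, ih, h1, ← divClass_mul_right _ _ g, divClass_add, map_mul,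
      tripletToPerm_gen, mul_assoc, mul_assoc] <;>
      simp only [map_mul, tripletToPerm_lift, tripletToPerm_gen]

theorem mem_commutator_of_pathChain_eq_zero {g : TripletGroup (m + 4)}
    (hg : tripletToPerm (m + 4) g = 1) (h : pathChain ℤ g = 0) :
    g ∈ ⁅PureTripletGroup (m + 4), PureTripletGroup (m + 4)⁆ := by
  have h1 := chainClass_pathChain g 1
  rw [h, map_zero, map_zero, hg, mul_one, divClass, abClass] at h1
  -- `s` lies over `1` but need not be `1`, so only the class of the conjugate `s * g * s⁻¹` is
  -- obtained; normality undoes the conjugation.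
  set s := lift (0 : Fin (m + 2)) 1
  have hs : s * g * s⁻¹ ∈ PureTripletGroup (m + 4) :=
    (inferInstance : (PureTripletGroup (m + 4)).Normal).conj_mem _ hg _
  rw [dif_pos hs, eq_comm, ofMul_eq_zero] at h1
  have h2 : (⟨s * g * s⁻¹, hs⟩ : PureTripletGroup (m + 4)) ∈ commutator _ :=
    (QuotientGroup.eq_one_iff _).1 h1
  have h3 : s * g * s⁻¹ ∈ ⁅PureTripletGroup (m + 4), PureTripletGroup (m + 4)⁆ := by
    rw [← Subgroup.map_subtype_commutator]
    exact ⟨_, h2, rfl⟩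
  have h4 := Subgroup.Normal.conj_mem inferInstance _ h3 s⁻¹
  convert h4 using 1
  group

/-- On pure elements the twist is trivial, so the crossed homomorphism is a homomorphism to an
abelian group. -/
theorem pathChain_eq_zero_of_mem_commutator (R : Type*) [CommRing R] {g : TripletGroup (m + 4)}
    (hg : g ∈ ⁅PureTripletGroup (m + 4), PureTripletGroup (m + 4)⁆) : pathChain R g = 0 := by
  let f : PureTripletGroup (m + 4) →* Multiplicative (Edge m → R) :=
    { toFun := fun k => Multiplicative.ofAdd (pathChain R (k : TripletGroup (m + 4)))
      map_one' := by rw [Subgroup.coe_one, pathChain_one, ofAdd_zero]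
      map_mul' := fun k l => by
        rw [Subgroup.coe_mul, pathChain_mul, (MonoidHom.mem_ker).1 k.2, permLinear_one, ofAdd_add] }
  rw [← Subgroup.map_subtype_commutator] at hg
  obtain ⟨k, hk, rfl⟩ := hg
  exact Abelianization.commutator_subset_ker f hk

end Triplet

namespace Triplet

variable {m : ℕ}

/-! ### The first homology of the graph -/

/-- The chain of a vertex. -/
noncomputable def vertexChain (i : Fin (m + 2)) (w : Equiv.Perm (Fin (m + 4))) : Vertex m → ℝ :=
  Pi.single (vertex i w) 1

theorem vertexChain_mul {i : Fin (m + 2)} {k : Fin (m + 3)}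
    (hk : k = i.castSucc ∨ k = i.succ) (w : Equiv.Perm (Fin (m + 4))) :
    vertexChain i (w * adj k) = vertexChain i w := by
  rw [vertexChain, vertex_mul (by rcases hk with rfl | rfl <;> simp), vertexChain]

/-- The boundary map of the graph. -/
noncomputable def boundary : (Edge m → ℝ) →ₗ[ℝ] (Vertex m → ℝ) :=
  Fintype.linearCombination ℝ (edgeLift (fun j w => vertexChain j.succ w - vertexChain j.castSucc w)
    fun j w => by
      rw [vertexChain_mul (Or.inl rfl), vertexChain_mul (Or.inr (Fin.succ_castSucc j).symm)])

theorem boundary_edgeChain (j : Fin (m + 1)) (w : Equiv.Perm (Fin (m + 4))) :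
    boundary (edgeChain ℝ j w) = vertexChain j.succ w - vertexChain j.castSucc w := by
  rw [boundary, edgeChain, Fintype.linearCombination_apply_single, one_smul, edgeLift_edge]

theorem boundary_basePath (w : Equiv.Perm (Fin (m + 4))) (k : Fin (m + 2)) :
    boundary (permLinear ℝ w (basePath ℝ k)) = vertexChain k w - vertexChain 0 w := by
  induction k using Fin.induction with
  | zero => rw [Fin.val_zero, basePath_zero, map_zero, map_zero, sub_self]
  | succ j ih =>
    rw [Fin.val_castSucc] at ih
    rw [Fin.val_succ, basePath_succ, map_add, map_add, ih, permLinear_edgeChain, mul_one,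
      boundary_edgeChain]
    abel

theorem boundary_pathChain (g : TripletGroup (m + 4)) (w : Equiv.Perm (Fin (m + 4))) :
    boundary (permLinear ℝ w (pathChain ℝ g)) =
      vertexChain 0 (w * tripletToPerm (m + 4) g) - vertexChain 0 w := by
  induction g using gen_induction generalizing w with
  | one => rw [pathChain_one, map_zero, map_zero, map_one, mul_one, sub_self]
  | mul g i ih =>
    obtain ⟨k, hk⟩ := exists_incident i
    rw [pathChain_mul, map_add, map_add, pathChain_gen_of_incident ℝ hk, map_sub, map_sub,
      ← permLinear_mul, ← permLinear_mul, tripletToPerm_gen, boundary_basePath,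
      boundary_basePath, ih, vertexChain_mul hk, map_mul, tripletToPerm_gen, mul_assoc]
    abel

/-- The chain of a path from the base vertex to a given vertex, extended linearly. -/
noncomputable def cone : (Vertex m → ℝ) →ₗ[ℝ] (Edge m → ℝ) :=
  Fintype.linearCombination ℝ
    (vertexLift (fun i w => pathChain ℝ (lift i w) + permLinear ℝ w (basePath ℝ i))
    fun i s hs w => by
      obtain ⟨k, rfl, hk⟩ : ∃ k, s = adj k ∧ (k = i.castSucc ∨ k = i.succ) := by
        rcases hs with rfl | rfl
        · exact ⟨_, rfl, Or.inl rfl⟩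
        · exact ⟨_, rfl, Or.inr rfl⟩
      rw [lift_mul_adj hk, pathChain_mul, pathChain_gen_of_incident ℝ hk, tripletToPerm_lift,
        map_sub, permLinear_mul]
      abel)

theorem cone_vertexChain (i : Fin (m + 2)) (w : Equiv.Perm (Fin (m + 4))) :
    cone (vertexChain i w) = pathChain ℝ (lift i w) + permLinear ℝ w (basePath ℝ i) := by
  rw [cone, vertexChain, Fintype.linearCombination_apply_single, one_smul, vertexLift_vertex]

/-- Connectedness of the graph, in algebraic form. -/
theorem boundary_cone (i : Fin (m + 2)) (w : Equiv.Perm (Fin (m + 4))) :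
    boundary (cone (vertexChain i w)) = vertexChain i w - vertexChain 0 1 := by
  have h := boundary_pathChain (lift i w) 1
  rw [permLinear_one, one_mul, tripletToPerm_lift] at h
  rw [cone_vertexChain, map_add, boundary_basePath, h]
  abel

theorem pathChain_mul_inv {a b : TripletGroup (m + 4)}
    (hab : tripletToPerm (m + 4) a = tripletToPerm (m + 4) b) :
    pathChain ℝ (a * b⁻¹) = pathChain ℝ a - pathChain ℝ b := by
  have h := pathChain_mul ℝ (a * b⁻¹) b
  rw [inv_mul_cancel_right, map_mul, map_inv, hab, mul_inv_cancel, permLinear_one] at h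
  rw [h, add_sub_cancel_right]

/-- Closing an edge up by the cone paths to its ends gives a loop, and this loop comes from a pure
element. -/
theorem edgeChain_sub_cone_boundary (j : Fin (m + 1)) (w : Equiv.Perm (Fin (m + 4))) :
    edgeChain ℝ j w - cone (boundary (edgeChain ℝ j w)) =
      pathChain ℝ (lift j.castSucc w * (lift j.succ w)⁻¹) := by
  rw [pathChain_mul_inv (by rw [tripletToPerm_lift, tripletToPerm_lift]), boundary_edgeChain,
    map_sub, cone_vertexChain, cone_vertexChain, Fin.val_succ, Fin.val_castSucc, basePath_succ,
    map_add, permLinear_edgeChain, mul_one]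
  abel

/-- The cycles of the graph. -/
noncomputable def cycles (m : ℕ) : Submodule ℝ (Edge m → ℝ) := LinearMap.ker boundary

theorem permLinear_pathChain_mem_cycles {g : TripletGroup (m + 4)}
    (hg : tripletToPerm (m + 4) g = 1) (w : Equiv.Perm (Fin (m + 4))) :
    permLinear ℝ w (pathChain ℝ g) ∈ cycles m := by
  rw [cycles, LinearMap.mem_ker, boundary_pathChain, hg, mul_one, sub_self]

theorem span_pathChain :
    Submodule.span ℝ (pathChain ℝ '' (PureTripletGroup (m + 4) : Set (TripletGroup (m + 4)))) =
      cycles m := by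
  refine le_antisymm (Submodule.span_le.2 ?_) fun x hx => ?_
  · rintro _ ⟨g, hg, rfl⟩
    have := permLinear_pathChain_mem_cycles hg 1
    rwa [permLinear_one] at this
  -- On a cycle `x ↦ x - cone (boundary x)` is the identity; by linearity it writes `x` as a
  -- combination of the loops attached to edges.
  · have hx' : x - cone (boundary x) = x := by
      rw [LinearMap.mem_ker.1 hx, map_zero, sub_zero]
    rw [← hx', ← LinearMap.comp_apply,
      pi_eq_sum_univ' x, map_sum, ← Finset.sum_sub_distrib]
    refine Submodule.sum_mem _ fun e _ => ?_
    rw [map_smul, ← smul_sub]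
    refine Submodule.smul_mem _ _ ?_
    obtain ⟨j, w, rfl⟩ := exists_edge_eq e
    rw [← edgeChain, LinearMap.comp_apply, edgeChain_sub_cone_boundary]
    refine Submodule.subset_span ⟨_, ?_, rfl⟩
    rw [SetLike.mem_coe, MonoidHom.mem_ker, map_mul, map_inv, tripletToPerm_lift,
      tripletToPerm_lift, mul_inv_cancel]

/-! ### Euler characteristic and the dimension of the cycle space. -/

/-- The sum of the coefficients. -/
noncomputable def augmentation (m : ℕ) : (Vertex m → ℝ) →ₗ[ℝ] ℝ :=
  Fintype.linearCombination ℝ fun _ => 1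

theorem augmentation_vertexChain (i : Fin (m + 2)) (w : Equiv.Perm (Fin (m + 4))) :
    augmentation m (vertexChain i w) = 1 := by
  rw [augmentation, vertexChain, Fintype.linearCombination_apply_single, one_smul]

theorem range_boundary : LinearMap.range (boundary (m := m)) = LinearMap.ker (augmentation m) := by
  apply le_antisymm
  · rw [LinearMap.range_le_ker_iff]
    refine LinearMap.pi_ext' fun e => LinearMap.ext_ring ?_
    obtain ⟨j, w, rfl⟩ := exists_edge_eq e
    change augmentation m (boundary (edgeChain ℝ j w)) = 0
    rw [boundary_edgeChain, map_sub, augmentation_vertexChain, augmentation_vertexChain, sub_self]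
  · intro y hy
    have h : boundary ∘ₗ cone =
        LinearMap.id - (augmentation m).smulRight (vertexChain 0 1) := by
      refine LinearMap.pi_ext' fun v => LinearMap.ext_ring ?_
      obtain ⟨i, w, rfl⟩ := exists_vertex_eq v
      change boundary (cone (vertexChain i w)) =
        vertexChain i w - augmentation m (vertexChain i w) • vertexChain 0 1
      rw [boundary_cone, augmentation_vertexChain, one_smul]
    refine ⟨cone y, ?_⟩
    have := LinearMap.congr_fun h y
    rw [LinearMap.comp_apply] at this
    rw [this, LinearMap.sub_apply, LinearMap.smulRight_apply, LinearMap.mem_ker.1 hy, zero_smul,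
      sub_zero, LinearMap.id_apply]

theorem finrank_cycles :
    Module.finrank ℝ (cycles m) + Fintype.card (Vertex m) = Fintype.card (Edge m) + 1 := by
  have h1 := LinearMap.finrank_range_add_finrank_ker (boundary (m := m))
  have h2 := LinearMap.finrank_range_add_finrank_ker (augmentation m)
  have h3 : LinearMap.range (augmentation m) = ⊤ := by
    rw [LinearMap.range_eq_top]
    intro r
    exact ⟨r • vertexChain 0 1, by rw [map_smul, augmentation_vertexChain, smul_eq_mul, mul_one]⟩
  rw [h3, finrank_top, Module.finrank_self, Module.finrank_fintype_fun_eq_card] at h2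
  rw [range_boundary, Module.finrank_fintype_fun_eq_card] at h1
  rw [cycles]
  omega

theorem finrank_cycles_cast :
    (Module.finrank ℝ (cycles m) : ℚ) =
      1 + (Nat.factorial (m + 4) : ℚ) * ((2 * ((m + 4 : ℕ) : ℚ) - 7) / 6) := by
  have h1 : (Module.finrank ℝ (cycles m) : ℚ) + Fintype.card (Vertex m) =
    Fintype.card (Edge m) + 1 := by exact_mod_cast finrank_cycles (m := m)
  have h2 : 2 * (Fintype.card (Edge m) : ℚ) = (m + 1) * Nat.factorial (m + 4) := by
    exact_mod_cast two_mul_card_edge (m := m)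
  have h3 : 6 * (Fintype.card (Vertex m) : ℚ) = (m + 2) * Nat.factorial (m + 4) := by
    exact_mod_cast six_mul_card_vertex (m := m)
  push_cast
  linarith

/-! ### Faithfulness of the holonomy representation -/

theorem val_adj (i : Fin (m + 3)) (x : Fin (m + 4)) :
    (adj i x : ℕ) =
      if (x : ℕ) = i then (i : ℕ) + 1 else if (x : ℕ) = i + 1 then (i : ℕ) else x := by
  simp only [adj, Equiv.swap_apply_def, Fin.ext_iff, Fin.val_castSucc, Fin.val_succ]
  split_ifs <;> simp

theorem edge_eq_iff {j : Fin (m + 1)} {v w : Equiv.Perm (Fin (m + 4))} :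
    edge j v = edge j w ↔ w = v ∨ w = v * adj j.succ.castSucc := by
  constructor
  · intro h
    have h1 : (v : Equiv.Perm (Fin (m + 4)) ⧸ Subgroup.closure {(adj j.succ.castSucc)}) = w := by
      exact eq_of_heq (Sigma.mk.inj h).2
    rw [QuotientGroup.eq, ← Subgroup.zpowers_eq_closure, Subgroup.mem_zpowers_iff] at h1
    obtain ⟨k, hk⟩ := h1
    rcases Int.even_or_odd' k with ⟨l, rfl | rfl⟩
    · left
      rw [zpow_mul, zpow_two, adj_mul_self, one_zpow, eq_inv_mul_iff_mul_eq, mul_one] at hk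
      exact hk.symm
    · right
      rw [zpow_add, zpow_mul, zpow_two, adj_mul_self, one_zpow, one_mul, zpow_one,
        eq_inv_mul_iff_mul_eq] at hk
      exact hk.symm
  · rintro (rfl | rfl)
    · rfl
    · rw [edge_mul_adj]

/-- The first and third generators commute in `S_n`, so the square of their product in `L_n` is pure
and gives a loop of four edges. If `q` fixes all its translates, the signs of the coefficients
confine every conjugate of `q⁻¹` to four permutations, which is possible only for `q = 1`. -/
theorem eq_one_of_permLinear_cycles (q : Equiv.Perm (Fin (m + 4)))
    (h : ∀ x ∈ cycles m, permLinear ℝ q x = x) : q = 1 := by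
  obtain ⟨a, ha⟩ : ∃ a : Fin (m + 3), (a : ℕ) = 0 := ⟨⟨0, by omega⟩, rfl⟩
  obtain ⟨b, hb⟩ : ∃ b : Fin (m + 3), (b : ℕ) = 1 := ⟨⟨1, by omega⟩, rfl⟩
  obtain ⟨c, hc⟩ : ∃ c : Fin (m + 3), (c : ℕ) = 2 := ⟨⟨2, by omega⟩, rfl⟩
  have hb' : (0 : Fin (m + 1)).succ.castSucc = b := Fin.ext (by rw [hb]; rfl)
  have hcomm : adj c * adj a = adj a * adj c := by
    ext x
    simp only [Equiv.Perm.mul_apply, val_adj, ha, hc]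
    split_ifs <;> grind
  have hac : adj a * adj c * adj a = adj c := by
    rw [mul_assoc, hcomm, ← mul_assoc, adj_mul_self, one_mul]
  have hacac : adj a * adj c * adj a * adj c = 1 := by rw [hac, adj_mul_self]
  have hDa : pathChain ℝ (gen a) = 0 := by
    rw [pathChain_gen, ha, basePath_zero, map_zero, sub_zero]
  have hDc : pathChain ℝ (gen c) = edgeChain ℝ 0 1 - edgeChain ℝ 0 (adj c) := by
    rw [pathChain_gen_of_incident ℝ (k := ⟨1, by omega⟩) (Or.inr (Fin.ext hc))]
    have := basePath_succ ℝ (0 : Fin (m + 1))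
    simp only
    rw [Fin.val_zero, basePath_zero, zero_add, zero_add] at this
    rw [this, permLinear_edgeChain, mul_one]
  set x : Edge m → ℝ := pathChain ℝ (gen a * gen c * gen a * gen c) with hx
  have hxp : tripletToPerm (m + 4) (gen a * gen c * gen a * gen c) = 1 := by
    simp only [map_mul, tripletToPerm_gen, hacac]
  have hxe : x = edgeChain ℝ 0 (adj a) - edgeChain ℝ 0 (adj a * adj c) +
      (edgeChain ℝ 0 (adj c) - edgeChain ℝ 0 1) := by
    simp only [hx, pathChain_mul, hDa, hDc, map_mul, tripletToPerm_gen, map_zero, map_sub,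
      permLinear_edgeChain, hac, adj_mul_self, mul_one, zero_add, add_zero]
  -- The negative coefficients sit on two edges, each with two coset representatives.
  have hneg : ∀ w, x (edge 0 w) < 0 ↔
      (w = 1 ∨ w = adj b ∨ w = adj a * adj c ∨ w = adj a * adj c * adj b) := by
    have hne : ∀ {v w : Equiv.Perm (Fin (m + 4))} (k : ℕ) (hk : k < m + 4),
        (w ⟨k, hk⟩ : ℕ) ≠ v ⟨k, hk⟩ → (w ⟨k, hk⟩ : ℕ) ≠ (v * adj b) ⟨k, hk⟩ →
          edge 0 v ≠ edge 0 w := by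
      intro v w k hk h1 h2 h3
      rcases edge_eq_iff.1 h3 with rfl | rfl
      · exact h1 rfl
      · rw [hb'] at h2
        exact h2 rfl
    have h1 : edge 0 (adj a) ≠ edge 0 1 := by
      apply hne 0 (by omega) <;> simp [val_adj, ha, hb]
    have h2 : edge 0 (adj c) ≠ edge 0 1 := by
      apply hne 2 (by omega) <;> simp [val_adj, hb, hc]
    have h3 : edge 0 (adj a) ≠ edge 0 (adj a * adj c) := by
      apply hne 2 (by omega) <;> simp [val_adj, ha, hb, hc]
    have h4 : edge 0 (adj c) ≠ edge 0 (adj a * adj c) := by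
      apply hne 0 (by omega) <;> simp [val_adj, ha, hb, hc]
    intro w
    have hw : (w = 1 ∨ w = adj b ∨ w = adj a * adj c ∨ w = adj a * adj c * adj b) ↔
        edge 0 w = edge 0 1 ∨ edge 0 w = edge 0 (adj a * adj c) := by
      rw [eq_comm (a := edge 0 w), eq_comm (a := edge 0 w), edge_eq_iff, edge_eq_iff, hb', one_mul,
        or_assoc]
    rw [hw, hxe]
    simp only [edgeChain, Pi.add_apply, Pi.sub_apply, Pi.single_apply]
    constructor
    · intro h
      by_contra hcon
      push Not at hcon
      rw [if_neg hcon.1, if_neg hcon.2] at h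
      split_ifs at h <;> norm_num at h
    · rintro (h | h)
      · rw [h, if_neg h1.symm, if_neg h2.symm, if_pos rfl]
        split_ifs <;> norm_num
      · rw [h, if_neg h3.symm, if_neg h4.symm, if_pos rfl]
        split_ifs <;> norm_num
  have hS : ∀ u, u⁻¹ * q⁻¹ * u = 1 ∨ u⁻¹ * q⁻¹ * u = adj b ∨ u⁻¹ * q⁻¹ * u = adj a * adj c ∨
      u⁻¹ * q⁻¹ * u = adj a * adj c * adj b := by
    intro u
    have h1 := congrFun (h _ (permLinear_pathChain_mem_cycles hxp u)) (edge 0 u)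
    rw [← hx, permLinear_apply, permLinear_apply, permLinear_apply, smul_edge, smul_edge,
      smul_edge, inv_mul_cancel, ← mul_assoc] at h1
    rw [← hneg, h1, hneg]
    exact Or.inl rfl
  -- All four permutations send `0` to `0` or `1`, whereas each nontrivial one has a conjugate by
  -- `adj a` or `adj b` that violates this.
  have hS0 : ∀ u, ((u⁻¹ * q⁻¹ * u) ⟨0, by omega⟩ : ℕ) < 2 := by
    intro u
    rcases hS u with h | h | h | h <;> rw [h] <;>
      simp [Equiv.Perm.mul_apply, val_adj, ha, hb, hc]
  have hinv : ∀ i : Fin (m + 3), (adj i)⁻¹ = adj i := fun i =>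
    inv_eq_of_mul_eq_one_left (adj_mul_self i)
  have h1 := hS 1
  rw [inv_one, one_mul, mul_one] at h1
  rcases h1 with h1 | h1 | h1 | h1
  · exact inv_eq_one.1 h1
  · have := hS0 (adj a)
    rw [hinv, h1] at this
    simp [Equiv.Perm.mul_apply, val_adj, ha, hb] at this
  · have := hS0 (adj b)
    rw [hinv, h1] at this
    simp [Equiv.Perm.mul_apply, val_adj, ha, hb, hc] at this
  · have := hS0 (adj a)
    rw [hinv, h1] at this
    simp [Equiv.Perm.mul_apply, val_adj, ha, hb, hc] at this

end Triplet

/-! ### Crystallographic subgroups of the Euclidean group -/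

section Crystallographic

open Topology

theorem isClosed_orthogonalGroup (d : ℕ) :
    IsClosed (Matrix.orthogonalGroup (Fin d) ℝ : Set (Matrix (Fin d) (Fin d) ℝ)) := by
  have : (Matrix.orthogonalGroup (Fin d) ℝ : Set (Matrix (Fin d) (Fin d) ℝ)) =
      {A | A * star A = 1} := by
    ext A; exact Matrix.mem_orthogonalGroup_iff (Fin d) ℝ
  rw [this]
  exact isClosed_eq (continuous_id.mul continuous_star) continuous_const

theorem compactSpace_orthogonalGroup (d : ℕ) :
    CompactSpace (Matrix.orthogonalGroup (Fin d) ℝ) := by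
  refine (isCompact_iff_compactSpace (X := Matrix (Fin d) (Fin d) ℝ)).1 ?_
  refine IsCompact.of_isClosed_subset
    (s := Set.pi Set.univ fun _ => Set.pi Set.univ fun _ => Set.Icc (-1 : ℝ) 1)
    ?_ (isClosed_orthogonalGroup d) ?_
  · exact isCompact_univ_pi fun _ => isCompact_univ_pi fun _ => isCompact_Icc
  · intro A hA i _ j _
    have h : ‖A i j‖ ≤ 1 := entry_norm_bound_of_unitary (𝕜 := ℝ) hA i j
    rw [Real.norm_eq_abs] at h
    exact abs_le.1 h

/-- An additive subgroup of `ℝᵈ` that spans it is cocompact. -/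
theorem exists_compact_of_span_eq_top {d : ℕ} (L : AddSubgroup (Fin d → ℝ))
    (hL : Submodule.span ℝ (L : Set (Fin d → ℝ)) = ⊤) :
    ∃ F : Set (Fin d → ℝ), IsCompact F ∧ ∀ x, ∃ l ∈ L, x + l ∈ F := by
  obtain ⟨b, hbL, hbs, hbi⟩ := exists_linearIndependent ℝ (L : Set (Fin d → ℝ))
  have : Finite b := hbi.finite
  cases nonempty_fintype b
  rw [hL] at hbs
  refine ⟨(fun c : b → ℝ => ∑ i, c i • (i : Fin d → ℝ)) '' Set.pi Set.univ fun _ => Set.Icc 0 1,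
    (isCompact_univ_pi fun _ => isCompact_Icc).image (by fun_prop), fun x => ?_⟩
  have hx : x ∈ Submodule.span ℝ (Set.range ((↑) : b → Fin d → ℝ)) := by
    rw [Subtype.range_coe, hbs]; trivial
  obtain ⟨c, rfl⟩ := (Submodule.mem_span_range_iff_exists_fun ℝ).1 hx
  -- Subtracting integer parts of the coordinates in a basis taken from `L` moves any point into the
  -- unit parallelepiped.
  refine ⟨∑ i, (-⌊c i⌋) • (i : Fin d → ℝ), sum_mem fun i _ => zsmul_mem (hbL i.2) _,
    fun i => Int.fract (c i), fun i _ => ⟨Int.fract_nonneg _, (Int.fract_lt_one _).le⟩, ?_⟩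
  simp only [← Finset.sum_add_distrib]
  refine Finset.sum_congr rfl fun i _ => ?_
  rw [← Int.cast_smul_eq_zsmul ℝ, ← add_smul, Int.fract]
  push_cast
  ring_nf

/-- The translation parts of the translations in a group of isometries. -/
def translationLattice {d : ℕ} (Γ : Subgroup (EuclideanGroup d)) : AddSubgroup (Fin d → ℝ) :=
  Subgroup.toAddSubgroup' (Γ.comap SemidirectProduct.inl)

theorem mem_translationLattice {d : ℕ} {Γ : Subgroup (EuclideanGroup d)} {v : Fin d → ℝ} :
    v ∈ translationLattice Γ ↔
      (SemidirectProduct.inl (Multiplicative.ofAdd v) : EuclideanGroup d) ∈ Γ := Iff.rfl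

/-- With finitely many linear parts, an element near `1` must be a translation, so discreteness
reduces to the lattice. Cocompactness follows from compactness of `O(d)` and of a region meeting
every lattice orbit. -/
theorem isCrystallographicSubgroup_of_lattice {d : ℕ} (Γ : Subgroup (EuclideanGroup d))
    (hfin : ((fun g : EuclideanGroup d => g.right) '' (Γ : Set (EuclideanGroup d))).Finite)
    (hdisc : ∃ U ∈ 𝓝 (0 : Fin d → ℝ), ∀ v ∈ translationLattice Γ, v ∈ U → v = 0)
    (hspan : Submodule.span ℝ (translationLattice Γ : Set (Fin d → ℝ)) = ⊤) :
    IsCrystallographicSubgroup Γ := by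
  have hl : Continuous (fun g : EuclideanGroup d => g.left) :=
    continuous_fst.comp (EuclideanGroup.isInducing d).continuous
  have hr : Continuous (fun g : EuclideanGroup d => g.right) :=
    continuous_snd.comp (EuclideanGroup.isInducing d).continuous
  have hD : DiscreteTopology Γ := by
    obtain ⟨U, hU, hUL⟩ := hdisc
    refine discreteTopology_of_isOpen_singleton_one ?_
    obtain ⟨O, hOU, hO, h0⟩ := mem_nhds_iff.1 hU
    have hS := (hfin.subset (Set.sdiff_subset (t := {1}))).isClosed.isOpen_compl
    have : ({1} : Set Γ) = Subtype.val ⁻¹'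
        ((fun g : EuclideanGroup d => Multiplicative.toAdd g.left) ⁻¹' O ∩
          (fun g : EuclideanGroup d => g.right) ⁻¹'
            ((fun g : EuclideanGroup d => g.right) '' (Γ : Set (EuclideanGroup d)) \ {1})ᶜ) := by
      ext ⟨g, hg⟩
      constructor
      · intro h
        obtain rfl : g = 1 := congrArg Subtype.val (Set.mem_singleton_iff.1 h)
        exact ⟨h0, fun h => h.2 rfl⟩
      · rintro ⟨h1, h2⟩
        have hr1 : g.right = 1 := by
          by_contra hne
          exact h2 ⟨⟨g, hg, rfl⟩, hne⟩
        have hgl : g = SemidirectProduct.inl g.left := SemidirectProduct.ext rfl hr1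
        have h3 := hUL (Multiplicative.toAdd g.left)
          (by rw [mem_translationLattice, ofAdd_toAdd, ← hgl]; exact hg) (hOU h1)
        exact Subtype.ext (SemidirectProduct.ext h3 hr1)
    rw [this]
    exact (((hO.preimage (continuous_toAdd.comp hl)).inter (hS.preimage hr))).preimage
      continuous_subtype_val
  refine ⟨hD, inferInstance, ?_⟩
  obtain ⟨F, hF, hFL⟩ := exists_compact_of_span_eq_top _ hspan
  have := compactSpace_orthogonalGroup d
  let f : Matrix.orthogonalGroup (Fin d) ℝ × (Fin d → ℝ) → EuclideanGroup d := fun p =>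
    SemidirectProduct.inr p.1 * SemidirectProduct.inl (Multiplicative.ofAdd p.2)
  have hf : Continuous f := by
    refine Continuous.mul ?_ ?_ <;> refine (EuclideanGroup.isInducing d).continuous_iff.2 ?_
    · exact continuous_const.prodMk continuous_fst
    · exact (continuous_ofAdd.comp continuous_snd).prodMk continuous_const
  have hcomp : IsCompact ((fun p => (f p : EuclideanGroup d ⧸ Γ)) '' (Set.univ ×ˢ F)) :=
    (isCompact_univ.prod hF).image (QuotientGroup.continuous_mk.comp hf)
  refine ⟨?_⟩
  convert hcomp
  refine (Set.eq_univ_of_forall fun x => ?_).symm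
  obtain ⟨g, rfl⟩ := QuotientGroup.mk_surjective x
  obtain ⟨l, hl, hlF⟩ := hFL (Multiplicative.toAdd (SemidirectProduct.inr g.right⁻¹ * g).left)
  refine ⟨(g.right, _), ⟨trivial, hlF⟩, ?_⟩
  rw [eq_comm, QuotientGroup.eq]
  have : g⁻¹ * f (g.right, Multiplicative.toAdd (SemidirectProduct.inr g.right⁻¹ * g).left + l) =
      SemidirectProduct.inl (Multiplicative.ofAdd l) := by
    rw [inv_mul_eq_iff_eq_mul]
    simp only [f, ofAdd_add, ofAdd_toAdd, map_mul, ← mul_assoc]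
    congr 1
    refine SemidirectProduct.ext ?_ ?_ <;> simp
  rw [this]
  exact hl

end Crystallographic

/-! ### Crystallographic groups from crossed homomorphisms to permutation modules -/

section CrossedHom

open Topology

theorem exists_orthonormal_dotProduct {E : Type*} [Fintype E] (W : Submodule ℝ (E → ℝ)) :
    ∃ b : Fin (Module.finrank ℝ W) → E → ℝ, (∀ i, b i ∈ W) ∧
      (∀ i j, b i ⬝ᵥ b j = if i = j then 1 else 0) ∧
      ∀ x ∈ W, ∑ i, (b i ⬝ᵥ x) • b i = x := by
  let e := WithLp.linearEquiv 2 ℝ (E → ℝ)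
  let W' : Submodule ℝ (EuclideanSpace ℝ E) := W.map e.symm.toLinearMap
  have hf : Module.finrank ℝ W' = Module.finrank ℝ W :=
    LinearEquiv.finrank_eq (e.symm.submoduleMap W).symm
  let b := (stdOrthonormalBasis ℝ W').reindex (finCongr hf)
  have hinner : ∀ x y : EuclideanSpace ℝ E, e x ⬝ᵥ e y = inner ℝ x y := fun x y => by
    rw [EuclideanSpace.inner_eq_star_dotProduct, dotProduct_comm]
    rfl
  refine ⟨fun i => e (b i : EuclideanSpace ℝ E), fun i => ?_, fun i j => ?_, fun x hx => ?_⟩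
  · obtain ⟨y, hy, hye⟩ := (b i).2
    have : e (b i : EuclideanSpace ℝ E) = y := by rw [← hye]; exact e.apply_symm_apply y
    change e (b i : EuclideanSpace ℝ E) ∈ W
    rw [this]
    exact hy
  · rw [hinner]
    exact orthonormal_iff_ite.1 b.orthonormal i j
  · have hx' : e.symm x ∈ W' := ⟨x, hx, rfl⟩
    have h := congrArg (fun y : W' => e (y : EuclideanSpace ℝ E)) (b.sum_repr' ⟨e.symm x, hx'⟩)
    simp only [AddSubmonoidClass.coe_finsetSum, Submodule.coe_smul, map_sum, map_smul,
      Submodule.coe_inner, ← hinner, LinearEquiv.apply_symm_apply] at h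
    exact h

variable {G Q E : Type*} [Group G] [Group Q] [MulAction Q E] [Fintype E]

theorem permLinear_dotProduct (q : Q) (x y : E → ℝ) :
    permLinear ℝ q x ⬝ᵥ permLinear ℝ q y = x ⬝ᵥ y :=
  Equiv.sum_comp (MulAction.toPerm q⁻¹) fun e => x e * y e

theorem dotProduct_permLinear (q : Q) (x y : E → ℝ) :
    x ⬝ᵥ permLinear ℝ q y = permLinear ℝ q⁻¹ x ⬝ᵥ y := by
  rw [← permLinear_dotProduct q (permLinear ℝ q⁻¹ x), ← permLinear_mul, mul_inv_cancel,
    permLinear_one]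

/-- A crossed homomorphism `D` to a real permutation module of a finite group `Q`, integral on the
kernel of `G → Q`, gives a map to a Euclidean group whose dimension is that of the span of the
values of `D` on the kernel, and whose image is crystallographic. -/
theorem exists_crystallographic_hom [Finite Q] (p : G →* Q) (hp : Function.Surjective p)
    (D : G → E → ℝ) (hD : ∀ g h, D (g * h) = D g + permLinear ℝ (p g) (D h))
    (W : Submodule ℝ (E → ℝ)) (hW : Submodule.span ℝ (D '' (p.ker : Set G)) = W)
    (hint : ∀ g e, ∃ z : ℤ, D g e = z)
    (hfaith : ∀ q : Q, (∀ x ∈ W, permLinear ℝ q x = x) → q = 1) :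
    ∃ Ψ : G →* EuclideanGroup (Module.finrank ℝ W), (∀ g, (Ψ g).right = 1 ↔ p g = 1) ∧
      (∀ g, Ψ g = 1 ↔ p g = 1 ∧ D g = 0) ∧ IsCrystallographicSubgroup Ψ.range := by
  obtain ⟨b, hbW, hbb, hb⟩ := exists_orthonormal_dotProduct W
  have hDW : ∀ g, p g = 1 → D g ∈ W := fun g hg => by
    rw [← hW]; exact Submodule.subset_span ⟨g, hg, rfl⟩
  have hD1 : D 1 = 0 := by
    have := hD 1 1
    rwa [mul_one, map_one, permLinear_one, left_eq_add] at this
  -- For `k` in the kernel, `D (g * k * g⁻¹)` is the translate of `D k` by `p g`, so the span is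
  -- stable.
  have hWinv : ∀ q : Q, ∀ x ∈ W, permLinear ℝ q x ∈ W := by
    intro q x hx
    obtain ⟨g, rfl⟩ := hp q
    rw [← hW] at hx
    induction hx using Submodule.span_induction with
    | mem x hx =>
      obtain ⟨k, hk, rfl⟩ := hx
      have hk : p k = 1 := hk
      have h1 : D (g * k * g⁻¹) = permLinear ℝ (p g) (D k) := by
        have h2 := hD g g⁻¹
        rw [mul_inv_cancel, hD1] at h2
        rw [hD, hD, map_mul, hk, mul_one, add_right_comm, ← h2, zero_add]
      rw [← h1]
      exact hDW _ (by simp [hk])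
    | zero => rw [map_zero]; exact W.zero_mem
    | add x y _ _ hx hy => rw [map_add]; exact W.add_mem hx hy
    | smul r x _ hx => rw [map_smul]; exact W.smul_mem r hx
  let L : (E → ℝ) →ₗ[ℝ] (Fin (Module.finrank ℝ W) → ℝ) :=
    { toFun := fun x i => b i ⬝ᵥ x
      map_add' := fun x y => by ext i; simp
      map_smul' := fun r x => by ext i; simp }
  have hLb : ∀ x ∈ W, ∑ i, L x i • b i = x := hb
  let A : Q → Matrix (Fin (Module.finrank ℝ W)) (Fin (Module.finrank ℝ W)) ℝ :=
    fun q => Matrix.of fun i j => b i ⬝ᵥ permLinear ℝ q (b j)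
  -- This holds for all `x`, not only in `W`: `L` gives the coordinates of the orthogonal projection
  -- to `W`, which commutes with `Q`. It is needed because `D g` may lie outside `W` when `p g ≠ 1`.
  have hAL : ∀ q x, Matrix.mulVec (A q) (L x) = L (permLinear ℝ q x) := by
    intro q x
    ext i
    change ∑ j, (b i ⬝ᵥ permLinear ℝ q (b j)) * (b j ⬝ᵥ x) = b i ⬝ᵥ permLinear ℝ q x
    rw [dotProduct_permLinear, ← hb _ (hWinv q⁻¹ _ (hbW i)), sum_dotProduct]
    refine Finset.sum_congr rfl fun j _ => ?_
    rw [smul_dotProduct, dotProduct_permLinear, smul_eq_mul,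
      dotProduct_comm (b j) (permLinear ℝ q⁻¹ (b i))]
  have hA1 : A 1 = 1 := by
    ext i j
    simp only [A, Matrix.of_apply, permLinear_one, hbb, Matrix.one_apply]
  have hAmul : ∀ q q', A (q * q') = A q * A q' := by
    intro q q'
    ext i j
    have := congrFun (hAL q (permLinear ℝ q' (b j))) i
    rw [← permLinear_mul] at this
    exact this.symm
  have hAstar : ∀ q, star (A q) = A q⁻¹ := by
    intro q
    ext i j
    simp only [A, Matrix.star_apply, Matrix.of_apply, star_trivial]
    rw [dotProduct_permLinear, dotProduct_comm]
  let Ahom : Q →* Matrix.orthogonalGroup (Fin (Module.finrank ℝ W)) ℝ :=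
    { toFun := fun q => ⟨A q, by
        rw [Matrix.mem_orthogonalGroup_iff, ← Matrix.conjTranspose_eq_transpose_of_trivial,
          ← Matrix.star_eq_conjTranspose, hAstar, ← hAmul, mul_inv_cancel, hA1]⟩
      map_one' := Subtype.ext hA1
      map_mul' := fun q q' => Subtype.ext (hAmul q q') }
  let Ψ : G →* EuclideanGroup (Module.finrank ℝ W) :=
    { toFun := fun g => ⟨Multiplicative.ofAdd (L (D g)), Ahom (p g)⟩
      map_one' := SemidirectProduct.ext (by simp [hD1]) (by simp)
      map_mul' := fun g h => by
        refine SemidirectProduct.ext ?_ (by simp)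
        change Multiplicative.ofAdd (L (D (g * h))) =
          Multiplicative.ofAdd (L (D g) + Matrix.mulVec (A (p g)) (L (D h)))
        rw [hAL, hD, map_add] }
  have hright : ∀ g, (Ψ g).right = 1 ↔ p g = 1 := by
    intro g
    constructor
    · intro h
      have hA : A (p g) = 1 := congrArg Subtype.val h
      refine hfaith _ fun x hx => ?_
      have h1 := hLb _ (hWinv (p g) x hx)
      rw [← hAL, hA, Matrix.one_mulVec, hLb x hx] at h1
      exact h1.symm
    · intro h
      change Ahom (p g) = 1
      rw [h, map_one]
  refine ⟨Ψ, hright, fun g => ?_, ?_⟩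
  · constructor
    · intro h
      have h1 : p g = 1 := (hright g).1 (by rw [h]; rfl)
      refine ⟨h1, ?_⟩
      have h2 : L (D g) = 0 := congrArg SemidirectProduct.left h
      rw [← hLb _ (hDW g h1), h2]
      simp
    · rintro ⟨h1, h2⟩
      refine SemidirectProduct.ext ?_ ((hright g).2 h1)
      change Multiplicative.ofAdd (L (D g)) = 1
      rw [h2, map_zero, ofAdd_zero]
  · have hlat : ∀ v, v ∈ translationLattice Ψ.range ↔ ∃ g, p g = 1 ∧ L (D g) = v := by
      intro v
      rw [mem_translationLattice]
      constructor
      · rintro ⟨g, hg⟩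
        exact ⟨g, (hright g).1 (by rw [hg]; rfl), congrArg SemidirectProduct.left hg⟩
      · rintro ⟨g, hg, rfl⟩
        exact ⟨g, SemidirectProduct.ext rfl ((hright g).2 hg)⟩
    refine isCrystallographicSubgroup_of_lattice _ ?_ ?_ ?_
    · refine (Set.finite_range Ahom).subset ?_
      rintro _ ⟨_, ⟨g, rfl⟩, rfl⟩
      exact ⟨p g, rfl⟩
    -- The neighbourhood is the preimage of the open sup-norm unit ball, where the only
    -- integer-valued chain is `0`.
    · refine ⟨(fun v : Fin (Module.finrank ℝ W) → ℝ => ∑ i, v i • b i) ⁻¹' Metric.ball 0 1,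
        (continuous_finsetSum _ fun i _ => by fun_prop).continuousAt.preimage_mem_nhds ?_, ?_⟩
      · simpa using Metric.ball_mem_nhds (0 : E → ℝ) one_pos
      · intro v hv hvU
        obtain ⟨g, hg, rfl⟩ := (hlat v).1 hv
        rw [Set.mem_preimage, hLb _ (hDW g hg), mem_ball_zero_iff] at hvU
        have : D g = 0 := by
          ext e
          obtain ⟨z, hz⟩ := hint g e
          have h1 := (norm_le_pi_norm (D g) e).trans_lt hvU
          rw [hz, Real.norm_eq_abs, ← Int.cast_abs] at h1
          have h2 : |z| < 1 := by exact_mod_cast h1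
          rw [hz, Int.abs_lt_one_iff.1 h2]
          simp
        rw [this, map_zero]
    · have hset : (translationLattice Ψ.range : Set _) = L '' (D '' (p.ker : Set G)) := by
        ext v
        rw [SetLike.mem_coe, hlat]
        simp [MonoidHom.mem_ker]
      rw [hset, ← Submodule.map_span, hW, eq_top_iff]
      intro v _
      refine ⟨∑ i, v i • b i, W.sum_mem fun i _ => W.smul_mem _ (hbW i), ?_⟩
      ext i
      change b i ⬝ᵥ (∑ j, v j • b j) = v i
      simp [dotProduct_sum, dotProduct_smul, hbb]

end CrossedHom

/-! ### The quotient of a triplet group by the commutator subgroup of its pure subgroup -/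

/-- The map from the abelianization of the pure triplet group induced by the inclusion. -/
noncomputable def pureAbelianizationMap (n : ℕ) :
    Abelianization (PureTripletGroup n) →* TripletQuotient n :=
  QuotientGroup.map _ _ (PureTripletGroup n).subtype (by
    rw [← Subgroup.map_le_iff_le_comap, Subgroup.map_subtype_commutator])

/-- The extension of the symmetric group given by a triplet group. -/
noncomputable def tripletExtension (n : ℕ) (hs : Function.Surjective (tripletToPerm n)) :
    GroupExtension (Abelianization (PureTripletGroup n)) (TripletQuotient n)
      (Equiv.Perm (Fin n)) where
  inl := pureAbelianizationMap n
  rightHom := QuotientGroup.lift _ (tripletToPerm n) (Subgroup.commutator_le_left _ _)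
  inl_injective := by
    rw [injective_iff_map_eq_one]
    intro z hz
    obtain ⟨x, rfl⟩ := QuotientGroup.mk_surjective z
    have h1 : (x : TripletGroup n) ∈ ⁅PureTripletGroup n, PureTripletGroup n⁆ :=
      (QuotientGroup.eq_one_iff _).1 hz
    rw [← Subgroup.map_subtype_commutator] at h1
    obtain ⟨y, hy, hyx⟩ := h1
    obtain rfl : y = x := Subtype.ext hyx
    exact (QuotientGroup.eq_one_iff _).2 hy
  range_inl_eq_ker_rightHom := by
    ext q
    constructor
    · rintro ⟨z, rfl⟩
      obtain ⟨x, rfl⟩ := QuotientGroup.mk_surjective z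
      exact x.2
    · intro hq
      obtain ⟨g, rfl⟩ := QuotientGroup.mk_surjective q
      exact ⟨QuotientGroup.mk (⟨g, hq⟩ : PureTripletGroup n), rfl⟩
  rightHom_surjective := fun w => by
    obtain ⟨g, hg⟩ := hs w
    exact ⟨g, hg⟩

/-! ### Torsion, and assembly of the theorem. -/

/-- A relation in `L_n` bounds the order from above, and the image in `S_n` bounds it from below. -/
theorem Triplet.exists_orderOf_eq (m : ℕ) :
    (∃ q : TripletQuotient (m + 4), orderOf q = 2) ∧
      ∃ q : TripletQuotient (m + 4), orderOf q = 3 := by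
  have key : ∀ (g : TripletGroup (m + 4)) (k : ℕ), g ^ k = 1 →
      orderOf (tripletToPerm (m + 4) g) = k → orderOf (g : TripletQuotient (m + 4)) = k := by
    intro g k hg hk
    refine Nat.dvd_antisymm (orderOf_dvd_of_pow_eq_one ?_) ?_
    · rw [← QuotientGroup.mk_pow, hg, QuotientGroup.mk_one]
    · rw [← hk]
      exact orderOf_map_dvd (tripletExtension (m + 4) tripletToPerm_surjective).rightHom
        (g : TripletQuotient (m + 4))
  refine ⟨⟨_, key (gen 0) 2 ?_ ?_⟩, ⟨_, key (gen (0 : Fin (m + 2)).castSucc * gen (Fin.succ 0)) 3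
    (gen_mul_gen_pow_three 0) ?_⟩⟩
  · rw [pow_two, gen_mul_self]
  · rw [tripletToPerm_gen, orderOf_adj]
  · rw [map_mul, tripletToPerm_gen, tripletToPerm_gen, orderOf_adj_mul_adj]

theorem Triplet.exists_crystallographic (m : ℕ) :
    ∃ Γ : Subgroup (EuclideanGroup (Module.finrank ℝ (cycles m))), IsCrystallographicSubgroup Γ ∧
      ∃ e : TripletQuotient (m + 4) ≃* Γ, ∀ g : TripletGroup (m + 4),
        ((e g : Γ) : EuclideanGroup (Module.finrank ℝ (cycles m))).right = 1 ↔
          tripletToPerm (m + 4) g = 1 := by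
  obtain ⟨Ψ, hright, hone, hcr⟩ := exists_crystallographic_hom (tripletToPerm (m + 4))
    tripletToPerm_surjective (pathChain ℝ) (pathChain_mul ℝ) (cycles m) span_pathChain
    (fun g e => ⟨_, pathChain_intCast ℝ g e⟩) eq_one_of_permLinear_cycles
  have hker : ⁅PureTripletGroup (m + 4), PureTripletGroup (m + 4)⁆ = Ψ.ker := by
    ext g
    rw [MonoidHom.mem_ker, hone]
    constructor
    · intro hg
      exact ⟨Subgroup.commutator_le_left _ _ hg, pathChain_eq_zero_of_mem_commutator ℝ hg⟩
    · rintro ⟨h1, h2⟩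
      refine mem_commutator_of_pathChain_eq_zero h1 (funext fun e => ?_)
      have := congrFun h2 e
      rw [pathChain_intCast, Pi.zero_apply, Int.cast_eq_zero] at this
      exact this
  exact ⟨Ψ.range, hcr, (QuotientGroup.quotientMulEquivOfEq hker).trans
    (QuotientGroup.quotientKerEquivRange Ψ), hright⟩

theorem theorem4p13 (n : ℕ) (hn : 4 ≤ n) :
    ∃ E : GroupExtension (Abelianization (PureTripletGroup n)) (TripletQuotient n)
        (Equiv.Perm (Fin n)),
      (∀ x : PureTripletGroup n,
        E.inl (Abelianization.of x) = ((x : TripletGroup n) : TripletQuotient n)) ∧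
      (∀ g : TripletGroup n, E.rightHom (g : TripletQuotient n) = tripletToPerm n g) ∧
      (∃ d : ℕ, (d : ℚ) = 1 + (Nat.factorial n : ℚ) * ((2 * (n : ℚ) - 7) / 6) ∧
        IsCrystallographicGroup d (TripletQuotient n) ∧
        -- the normal subgroup of the extension is the subgroup of translations
        ∃ Γ : Subgroup (EuclideanGroup d), IsCrystallographicSubgroup Γ ∧
          ∃ e : TripletQuotient n ≃* Γ, ∀ q : TripletQuotient n,
            (e q : EuclideanGroup d).right = 1 ↔ q ∈ E.inl.range) ∧
      (∀ k : ℕ, ¬ IsBieberbachGroup k (TripletQuotient n)) ∧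
      (∃ q : TripletQuotient n, orderOf q = 2) ∧
      (∃ q : TripletQuotient n, orderOf q = 3) := by

  obtain ⟨m, rfl⟩ : ∃ m, n = m + 4 := ⟨n - 4, by omega⟩
  obtain ⟨Γ, hΓ, e, he⟩ := Triplet.exists_crystallographic m
  obtain ⟨⟨q, hq⟩, h3⟩ := Triplet.exists_orderOf_eq m
  refine ⟨tripletExtension (m + 4) Triplet.tripletToPerm_surjective, fun x => rfl, fun g => rfl,
    ⟨_, Triplet.finrank_cycles_cast, ⟨Γ, hΓ, ⟨e⟩⟩, Γ, hΓ, e, fun q => ?_⟩, ?_, ⟨q, hq⟩, h3⟩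
  · rw [GroupExtension.range_inl_eq_ker_rightHom]
    obtain ⟨g, rfl⟩ := QuotientGroup.mk_surjective q
    exact he g
  · rintro k ⟨-, hk⟩
    have h1 : q = 1 := hk q (orderOf_pos_iff.1 (by omega))
    rw [h1, orderOf_one] at hq
    omega
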